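/- There is a universal constant $C>0$ such that the following holds. Let $n\ge 2$, let $X_1,\dots,X_n$ be independent, not necessarily identically distributed random variables with values in a measurable space $\chi$, and let $\epsilon_1,\dots,\epsilon_n$ be independent Rademacher variables that are independent of $(X_1,\dots,X_n)$. Let $\mathcal F$ be a nonempty countable class of arrays $f=(f_{i,j})_{1\le i\ne j\le n}$ of measurable functions $f_{i,j}:\chi\times\chi\to\mathbb R$ that is uniformly bounded by $R$, that is, $|f_{i,j}(x,x')|\le R$ for all $f\in\mathcal F$, $i\neq j$ and $x,x'\in\chi$. Let $F=(F_{i,j})_{i\neq j}$ be a measurable envelope: $|f_{i,j}(x,x')|\le F_{i,j}(x,x')$ for all $f\in\mathcal F$, $i\ne j$, $x,x'\in\chi$. Put $$\|F\|_{2,P}^2:=\frac1{n(n-1)}\sum_{1\le i\ne j\le n}\mathbb E[F_{i,j}^2(X_i,X_j)]$$ and suppose that $0<\|F\|_{2,P}<\infty$. For a discrete probability measure $Q$ with labelled atoms $z_1,\dots,z_t\in\chi$, $2\le t\le n$ (two labels may carry the same point), of masses $q_1,\dots,q_t>0$, $\sum_i q_i=1$, let $$\|f\|_{2,Q}^2:=\frac{\sum_{1\le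 i\ne j\le t}f_{i,j}^2(z_i,z_j)\,q_iq_j}{\sum_{1\le i\ne j\le t}q_iq_j},$$ and let $N(\eta,\mathcal F,\|\cdot\|_{2,Q})\in\{1,2,\dots,\infty\}$ be the least $m$ for which there are $f^{(1)},\dots,f^{(m)}\in\mathcal F$ with $\sup_{f\in\mathcal F}\min_{k\le m}\|f-f^{(k)}\|_{2,Q}\le\eta$. For $\delta>0$ define the uniform entropy integrals $$J_2(\delta):=\sup_Q\int_0^\delta\bigl(1+\log N(\eta\|F\|_{2,Q},\mathcal F,\|\cdot\|_{2,Q})\bigr)\,d\eta,\qquad J_2^{0}(\delta):=\sup_Q\int_0^\delta\log N(\eta\|F\|_{2,Q},\mathcal F,\|\cdot\|_{2,Q})\,d\eta,$$ with values in $[0,\infty]$. Let \begin{align*} \Gamma_{n,1}^2&:=\mathbb E\Bigl[\sup_{f\in\mathcal F}\tfrac1{n(n-1)}\Bigl|\sum_{i\ne j}\bigl\{\mathbb E[f_{i,j}^2(X_i,X_j)\mid X_i]-\mathbb E[f_{i,j}^2(X_i,X_j)]\bigr\}\Bigr|\Bigr],\\ \Gamma_{n,2}^2&:=\mathbb E\Bigl[\sup_{f\in\mathcal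 F}\tfrac1{n(n-1)}\Bigl|\sum_{i\ne j}\bigl\{\mathbb E[f_{i,j}^2(X_i,X_j)\mid X_j]-\mathbb E[f_{i,j}^2(X_i,X_j)]\bigr\}\Bigr|\Bigr],\\ \Sigma_n^2&:=\sup_{f\in\mathcal F}\tfrac1{n(n-1)}\sum_{i\ne j}\mathbb E[f_{i,j}^2(X_i,X_j)],\\ A_n^2&:=\|F\|_{2,P}^{-2}\bigl[\Gamma_{n,1}^2+\Gamma_{n,2}^2+\Sigma_n^2\bigr],\qquad B_n^2:=\frac{R}{n\|F\|_{2,P}}. \end{align*} Then for all real $a>0$ and $b\ge 0$ with $a\ge A_n$ and $b\ge B_n$, $$\mathbb E\left[\sup_{f\in\mathcal F}\left|\frac{\sum_{1\le i\ne j\le n}\epsilon_i\epsilon_jf_{i,j}(X_i,X_j)}{\sqrt{n(n-1)}}\right|\right]\le C\,\|F\|_{2,P}\,J_2(a)\left[1+\frac{J_2(a)\,b^2}{a^2}\right].$$ If moreover the zero array belongs to $\mathcal F$, then the same inequality holds with $J_2^{0}$ in place of $J_2$. -/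

import Mathlib

open MeasureTheory ProbabilityTheory
open scoped ENNReal NNReal

namespace UProc

/-- Arrays `f = (f i j)` of kernels `f i j : χ × χ → ℝ` (curried). Only the entries with `i ≠ j`
are ever used: nothing below is assumed of, or depends on, the diagonal entries `f i i`. -/
abbrev Kernels (n : ℕ) (χ : Type*) := Fin n → Fin n → χ → χ → ℝ

/-- The index pairs `(i, j)` with `i ≠ j`. -/
def pairs (t : ℕ) : Finset (Fin t × Fin t) := Finset.univ.filter fun p => p.1 ≠ p.2

/-- A discrete probability measure `Q` with labelled atoms `z 0, …, z (t - 1)` of masses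
`q 0, …, q (t - 1) > 0`, where `2 ≤ t ≤ n`. As the `i`-th atom is fed to the kernels with index
`i`, the atoms are labelled, and two labels may carry the same point (as happens for the
empirical measure of a sample with ties). -/
structure DiscreteMeasure (n : ℕ) (χ : Type*) where
  t : ℕ
  two_le : 2 ≤ t
  le_n : t ≤ n
  z : Fin t → χ
  q : Fin t → ℝ
  q_pos : ∀ i, 0 < q i
  q_sum : ∑ i, q i = 1

/-- `‖f‖_{2,Q} = (∑_{i ≠ j} f_{ij}(z_i, z_j)² q_i q_j / ∑_{i ≠ j} q_i q_j)^{1/2}`. -/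
noncomputable def normQ {n : ℕ} {χ : Type*} (Q : DiscreteMeasure n χ) (f : Kernels n χ) : ℝ :=
  Real.sqrt ((∑ p ∈ pairs Q.t,
      (f (Fin.castLE Q.le_n p.1) (Fin.castLE Q.le_n p.2) (Q.z p.1) (Q.z p.2)) ^ 2
        * (Q.q p.1 * Q.q p.2)) /
    ∑ p ∈ pairs Q.t, Q.q p.1 * Q.q p.2)

/-- `N(η, 𝓕, ‖·‖_{2,Q})`: the least number of elements of `𝓕` such that every element of `𝓕` is
within distance `η` of one of them (`⊤` if there is no such finite number). -/
noncomputable def coveringNumber {n : ℕ} {χ : Type*} (η : ℝ) (𝓕 : Set (Kernels n χ))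
    (Q : DiscreteMeasure n χ) : ℕ∞ :=
  ⨅ (S : Finset (Kernels n χ)) (_ : (S : Set (Kernels n χ)) ⊆ 𝓕)
    (_ : ∀ f ∈ 𝓕, ∃ g ∈ S, normQ Q (f - g) ≤ η), (S.card : ℕ∞)

/-- `log N(η, 𝓕, ‖·‖_{2,Q})`, with value `∞` if the covering number is infinite. -/
noncomputable def entropy {n : ℕ} {χ : Type*} (η : ℝ) (𝓕 : Set (Kernels n χ))
    (Q : DiscreteMeasure n χ) : ℝ≥0∞ :=
  (ENNReal.log (coveringNumber η 𝓕 Q : ℝ≥0∞)).toENNReal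

/-- `sup_Q ∫_0^δ (c + log N(η ‖F‖_{2,Q}, 𝓕, ‖·‖_{2,Q})) dη`. The uniform entropy integral is
the case `c = 1`; the case `c = 0` is used for classes that contain the zero kernel. -/
noncomputable def J₂ {n : ℕ} {χ : Type*} (c : ℝ≥0∞) (F : Kernels n χ) (𝓕 : Set (Kernels n χ))
    (δ : ℝ) : ℝ≥0∞ :=
  ⨆ Q : DiscreteMeasure n χ, ∫⁻ η in Set.Ioc 0 δ, (c + entropy (η * normQ Q F) 𝓕 Q)

/-- `n (n - 1)`, as a real number. -/
def numPairs (n : ℕ) : ℝ := (n : ℝ) * ((n : ℝ) - 1)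

section Probability

variable {Ω χ : Type*} [mΩ : MeasurableSpace Ω] [mχ : MeasurableSpace χ] {n : ℕ}

/-- `ε` is a Rademacher variable: it takes each of the values `1` and `-1` with probability 1/2. -/
def IsRademacher (μ : Measure Ω) (ε : Ω → ℝ) : Prop :=
  Measurable ε ∧ μ {ω | ε ω = 1} = 1 / 2 ∧ μ {ω | ε ω = -1} = 1 / 2

/-- `E sup_{f ∈ 𝓕} |∑_{i ≠ j} ε_i ε_j f_{ij}(X_i, X_j) / √(n (n - 1))|`. -/
noncomputable def expectedSup (μ : Measure Ω) (X : Fin n → Ω → χ) (ε : Fin n → Ω → ℝ)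
    (𝓕 : Set (Kernels n χ)) : ℝ≥0∞ :=
  ∫⁻ ω, ⨆ f ∈ 𝓕, ENNReal.ofReal
    |(∑ p ∈ pairs n, ε p.1 ω * ε p.2 ω * f p.1 p.2 (X p.1 ω) (X p.2 ω)) /
      Real.sqrt (numPairs n)| ∂μ

/-- `‖F‖_{2,P} = ((n (n - 1))⁻¹ ∑_{i ≠ j} E F_{ij}(X_i, X_j)²)^{1/2}`. -/
noncomputable def normP (μ : Measure Ω) (X : Fin n → Ω → χ) (F : Kernels n χ) : ℝ≥0∞ :=
  ((∑ p ∈ pairs n, ∫⁻ ω, ENNReal.ofReal ((F p.1 p.2 (X p.1 ω) (X p.2 ω)) ^ 2) ∂μ) /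
    ENNReal.ofReal (numPairs n)) ^ (1 / 2 : ℝ)

/-- The random variable `f_{ij}(X_i, X_j)²`. -/
def sqKernel (X : Fin n → Ω → χ) (f : Kernels n χ) (i j : Fin n) (ω : Ω) : ℝ :=
  (f i j (X i ω) (X j ω)) ^ 2

/-- `Γ_{n,1}²`; the conditional expectations are given `X_i`. -/
noncomputable def Gamma₁Sq (μ : Measure Ω) (X : Fin n → Ω → χ) (𝓕 : Set (Kernels n χ)) : ℝ≥0∞ :=
  ∫⁻ ω, ⨆ f ∈ 𝓕, ENNReal.ofReal ((1 / numPairs n) *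
    |∑ p ∈ pairs n, ((μ[sqKernel X f p.1 p.2 | MeasurableSpace.comap (X p.1) mχ]) ω
      - ∫ ω', sqKernel X f p.1 p.2 ω' ∂μ)|) ∂μ

/-- `Γ_{n,2}²`; the conditional expectations are given `X_j`. -/
noncomputable def Gamma₂Sq (μ : Measure Ω) (X : Fin n → Ω → χ) (𝓕 : Set (Kernels n χ)) : ℝ≥0∞ :=
  ∫⁻ ω, ⨆ f ∈ 𝓕, ENNReal.ofReal ((1 / numPairs n) *
    |∑ p ∈ pairs n, ((μ[sqKernel X f p.1 p.2 | MeasurableSpace.comap (X p.2) mχ]) ω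
      - ∫ ω', sqKernel X f p.1 p.2 ω' ∂μ)|) ∂μ

/-- `Σ_n² = sup_{f ∈ 𝓕} (n (n - 1))⁻¹ ∑_{i ≠ j} E f_{ij}(X_i, X_j)²`. -/
noncomputable def SigmaSq (μ : Measure Ω) (X : Fin n → Ω → χ) (𝓕 : Set (Kernels n χ)) : ℝ≥0∞ :=
  ⨆ f ∈ 𝓕, ENNReal.ofReal ((1 / numPairs n) *
    ∑ p ∈ pairs n, ∫ ω, sqKernel X f p.1 p.2 ω ∂μ)

/-- `A_n = (‖F‖_{2,P}⁻² (Γ_{n,1}² + Γ_{n,2}² + Σ_n²))^{1/2}`. -/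
noncomputable def A (μ : Measure Ω) (X : Fin n → Ω → χ) (F : Kernels n χ)
    (𝓕 : Set (Kernels n χ)) : ℝ≥0∞ :=
  ((Gamma₁Sq μ X 𝓕 + Gamma₂Sq μ X 𝓕 + SigmaSq μ X 𝓕) / normP μ X F ^ 2) ^ (1 / 2 : ℝ)

/-- `B_n = (R / (n ‖F‖_{2,P}))^{1/2}`. -/
noncomputable def B (μ : Measure Ω) (X : Fin n → Ω → χ) (F : Kernels n χ) (R : ℝ) : ℝ≥0∞ :=
  (ENNReal.ofReal R / (n * normP μ X F)) ^ (1 / 2 : ℝ)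

end Probability

end UProc

/-! The mechanism is a bound for one Rademacher chaos, used twice: for the class itself and for the
class of its squares.

Decoupling. For a uniformly random subset `B` of the indices, the sum over `B × Bᶜ` averages to a
quarter of the sum over all pairs `i ≠ j`, so it suffices to treat one block. Conditionally on the
sample, the block chaos is linear in the signs of `B` and in those of `Bᶜ`. Integrating out first
one group and then the other shows that it is subexponential with scale proportional to the `ℓ²`
norm of its coefficients (`sum_exp_abs_chaos_le`).

Chaining. Let `φ` be the empirical norm of `F` and `σ` the supremum of the empirical norms over `𝓕`.
Chaining along dyadic nets bounds the conditional expectation of the supremum, up to the factor `√(n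
(n - 1))`, by a multiple of `φ ∫_0^{σ/(2φ)} (1 + log N)` (`sum_iSup_chaos_le_lintegral`). The
integrand is nonincreasing, so an integral over `(0, δ]` is at most `1 + δ/a` times the one over
`(0, a]`. This yields a multiple of `J₂(a) (φ + σ/a)` (`sum_iSup_chaos_le`). The random quantities
enter linearly, so expectations can be taken with no concavity argument.

The radius. It remains to bound `E σ`, and `(E σ)² ≤ E σ²`. The Hoeffding decomposition of `f²`
consists of the mean, two projections and a completely degenerate part. The first three are
controlled by `Σ_n²`, `Γ_{n,1}²` and `Γ_{n,2}²`. The degenerate part symmetrizes to a Rademacher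
chaos of the squares (`lintegral_degenerate_le`). Squaring is `2R`-Lipschitz on `[-R, R]`, so the
same chaining bound applies with the entropy of `𝓕`. The result is a quadratic inequality for `E σ`,
which `mul_add_div_le_of_sq_le` solves.

Zero array. If `0 ∈ 𝓕`, one ball of radius less than `σ/2` cannot cover `𝓕`. Hence `log N ≥ log 2`
on the range of the chaining integral, and the summand `1` is absorbed into `log N`. -/

namespace UProc

/-! ### Exponential moments of a decoupled Rademacher chaos -/

section Chaos

variable {ι : Type*} [DecidableEq ι]

/-- The real number `1` or `-1` given by a sign. -/
def sgn (u : ℤˣ) : ℝ := ((u : ℤ) : ℝ)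

lemma sgn_neg (u : ℤˣ) : sgn (-u) = -sgn u := by simp [sgn]

lemma sgn_eq_or (u : ℤˣ) : sgn u = 1 ∨ sgn u = -1 := by
  rcases Int.units_eq_one_or u with h | h <;> simp [sgn, h]

lemma abs_sgn (u : ℤˣ) : |sgn u| = 1 := by
  rcases sgn_eq_or u with h | h <;> simp [h]

/-- Change the sign with index `b`. -/
def flip (b : ι) (s : ι → ℤˣ) : ι → ℤˣ := Function.update s b (-s b)

lemma flip_same (b : ι) (s : ι → ℤˣ) : flip b s b = -s b := by simp [flip]

lemma flip_ne {b i : ι} (h : i ≠ b) (s : ι → ℤˣ) : flip b s i = s i := by simp [flip, h]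

lemma flip_involutive (b : ι) : Function.Involutive (flip b) := by
  intro s
  ext i
  by_cases h : i = b
  · subst h; simp [flip]
  · simp [flip, h]

variable [Fintype ι]

lemma sum_flip (b : ι) (Φ : (ι → ℤˣ) → ℝ) : ∑ s, Φ (flip b s) = ∑ s, Φ s :=
  Equiv.sum_comp (flip_involutive b).toPerm Φ

lemma sum_eq_half_flip (b : ι) (Φ : (ι → ℤˣ) → ℝ) :
    ∑ s, Φ s = ∑ s, (Φ s + Φ (flip b s)) / 2 := by
  rw [← Finset.sum_div, Finset.sum_add_distrib, sum_flip]; ring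

/-- The moment generating function of a Rademacher sum whose coefficients may depend on
the other signs. -/
lemma sum_exp_linear_le (B : Finset ι) (Y : ι → (ι → ℤˣ) → ℝ)
    (hY : ∀ b ∈ B, ∀ i ∈ B, ∀ s, Y i (flip b s) = Y i s) (G : (ι → ℤˣ) → ℝ)
    (hG : ∀ b ∈ B, ∀ s, G (flip b s) = G s) :
    ∑ s, Real.exp (∑ i ∈ B, sgn (s i) * Y i s + G s)
      ≤ ∑ s, Real.exp (∑ i ∈ B, Y i s ^ 2 / 2 + G s) := by
  induction B using Finset.induction_on generalizing G with
  | empty => simp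
  | insert b B hb ih =>
    -- Averaging over the sign `b` gives `cosh (Y b)`, which is at most `exp (Y b ^ 2 / 2)`. This
    -- factor does not see the remaining signs of `B`, so it is moved into `G`; hence the induction
    -- for all `G`.
    have hbB : ∀ i ∈ B, i ≠ b := fun i hi h => hb (h ▸ hi)
    calc ∑ s, Real.exp (∑ i ∈ insert b B, sgn (s i) * Y i s + G s)
        = ∑ s, Real.cosh (Y b s) * Real.exp (∑ i ∈ B, sgn (s i) * Y i s + G s) := by
          rw [sum_eq_half_flip b]
          refine Finset.sum_congr rfl fun s _ => ?_
          have h1 : ∑ i ∈ B, sgn (flip b s i) * Y i (flip b s)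
              = ∑ i ∈ B, sgn (s i) * Y i s :=
            Finset.sum_congr rfl fun i hi => by
              rw [flip_ne (hbB i hi), hY b (by simp) i (by simp [hi])]
          rw [Finset.sum_insert hb, Finset.sum_insert hb, h1, flip_same, sgn_neg,
            hY b (by simp) b (by simp), hG b (by simp), Real.cosh_eq]
          rcases sgn_eq_or (s b) with h | h <;> rw [h] <;> simp only [add_assoc, Real.exp_add]
            <;> simp <;> ring
      _ ≤ ∑ s, Real.exp (∑ i ∈ B, sgn (s i) * Y i s + (Y b s ^ 2 / 2 + G s)) := by
          refine Finset.sum_le_sum fun s _ => ?_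
          have := Real.cosh_le_exp_half_sq (Y b s)
          calc _ ≤ Real.exp (Y b s ^ 2 / 2) * Real.exp (∑ i ∈ B, sgn (s i) * Y i s + G s) := by
                gcongr
            _ = _ := by rw [← Real.exp_add]; congr 1; ring
      _ ≤ ∑ s, Real.exp (∑ i ∈ B, Y i s ^ 2 / 2 + (Y b s ^ 2 / 2 + G s)) :=
          ih (fun c hc i hi => hY c (by simp [hc]) i (by simp [hi])) _
            fun c hc s => by rw [hY c (by simp [hc]) b (by simp), hG c (by simp [hc])]
      _ = _ := by
          refine Finset.sum_congr rfl fun s _ => ?_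
          rw [Finset.sum_insert hb]; congr 1; ring

/-- The exponential moments of the square of a Rademacher sum. -/
lemma sum_exp_sq_le (B : Finset ι) (a : ι → ℝ) (c t : ℝ) (ht : 0 ≤ t)
    (h : 2 * t * ∑ j ∈ B, a j ^ 2 < 1) :
    ∑ s : ι → ℤˣ, Real.exp (t * (c + ∑ j ∈ B, sgn (s j) * a j) ^ 2)
      ≤ Fintype.card (ι → ℤˣ) *
        Real.exp ((c ^ 2 + ∑ j ∈ B, a j ^ 2) * (t / (1 - 2 * t * ∑ j ∈ B, a j ^ 2))) := by
  induction B using Finset.induction_on generalizing t with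
  | empty => simp [mul_comm]
  | insert b B hb ih =>
    have hbB : ∀ i ∈ B, i ≠ b := fun i hi h => hb (h ▸ hi)
    rw [Finset.sum_insert hb] at h ⊢
    set v := ∑ j ∈ B, a j ^ 2 with hv
    have hv0 : 0 ≤ v := Finset.sum_nonneg fun j _ => sq_nonneg _
    set e := a b ^ 2 with he
    have he0 : 0 ≤ e := sq_nonneg _
    -- With `w` the rest of the sum, averaging over the sign `b` produces `cosh (2 t w a_b) ≤ exp (2
    -- t² w² e)`. The square of the shorter sum thus reappears with `t` raised to `t'`.
    set t' := t * (1 + 2 * t * e) with ht'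
    have ht'0 : 0 ≤ t' := by positivity
    have hd : 0 < 1 - 2 * t * (e + v) := by linarith
    have hte : 0 ≤ t * e := by positivity
    have htv : 0 ≤ t * v := by positivity
    have h1 : 2 * t' * v < 1 := by rw [ht']; nlinarith
    have hd' : 0 < 1 - 2 * t' * v := by linarith
    have hfrac : t' / (1 - 2 * t' * v) ≤ t / (1 - 2 * t * (e + v)) := by
      rw [div_le_div_iff₀ hd' hd, ht']
      have : 0 ≤ t * (t * e) ^ 2 := by positivity
      nlinarith
    have hfrac1 : t ≤ t / (1 - 2 * t * (e + v)) := by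
      rw [le_div_iff₀ hd]
      have : 0 ≤ t * (t * e + t * v) := by positivity
      nlinarith
    calc ∑ s : ι → ℤˣ, Real.exp (t * (c + ∑ j ∈ insert b B, sgn (s j) * a j) ^ 2)
        ≤ ∑ s : ι → ℤˣ, Real.exp (t * e) *
            Real.exp (t' * (c + ∑ j ∈ B, sgn (s j) * a j) ^ 2) := by
          rw [sum_eq_half_flip b]
          refine Finset.sum_le_sum fun s _ => ?_
          have h1 : ∑ i ∈ B, sgn (flip b s i) * a i = ∑ i ∈ B, sgn (s i) * a i :=
            Finset.sum_congr rfl fun i hi => by rw [flip_ne (hbB i hi)]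
          rw [Finset.sum_insert hb, Finset.sum_insert hb, h1, flip_same, sgn_neg]
          set w := c + ∑ j ∈ B, sgn (s j) * a j with hw
          have key : (Real.exp (t * (w + a b) ^ 2) + Real.exp (t * (w - a b) ^ 2)) / 2
              ≤ Real.exp (t * e) * Real.exp (t' * w ^ 2) := by
            have := Real.cosh_le_exp_half_sq (2 * t * w * a b)
            calc _ = Real.exp (t * e) * Real.exp (t * w ^ 2) * Real.cosh (2 * t * w * a b) := by
                  rw [Real.cosh_eq, ← Real.exp_add]
                  rw [mul_div_assoc', mul_add, ← Real.exp_add, ← Real.exp_add, he]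
                  congr 3 <;> ring
              _ ≤ Real.exp (t * e) * Real.exp (t * w ^ 2) *
                    Real.exp ((2 * t * w * a b) ^ 2 / 2) := by gcongr
              _ = _ := by
                  rw [← Real.exp_add, ← Real.exp_add, ← Real.exp_add, ht', he]
                  congr 1; ring
          refine le_trans (le_of_eq ?_) key
          rcases sgn_eq_or (s b) with h | h <;> rw [h]
          · congr 3
            · congr 2; rw [hw]; ring
            · congr 2; rw [hw]; ring
          · rw [add_comm (Real.exp _)]
            congr 3
            · congr 2; rw [hw]; ring
            · congr 2; rw [hw]; ring
      _ = Real.exp (t * e) * ∑ s : ι → ℤˣ,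
            Real.exp (t' * (c + ∑ j ∈ B, sgn (s j) * a j) ^ 2) := by rw [Finset.mul_sum]
      _ ≤ Real.exp (t * e) * (Fintype.card (ι → ℤˣ) *
            Real.exp ((c ^ 2 + v) * (t' / (1 - 2 * t' * v)))) := by
          gcongr
          exact ih t' ht'0 h1
      _ = Fintype.card (ι → ℤˣ) *
            Real.exp (t * e + (c ^ 2 + v) * (t' / (1 - 2 * t' * v))) := by
          rw [Real.exp_add]; ring
      _ ≤ _ := by
          gcongr
          have h2 := mul_le_mul_of_nonneg_left hfrac (by positivity : 0 ≤ c ^ 2 + v)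
          have h3 := mul_le_mul_of_nonneg_right hfrac1 he0
          nlinarith

/-- The decoupled Rademacher chaos `∑_{i ∈ B, j ∉ B} s_i s_j a_{ij}`. -/
def chaos (B : Finset ι) (a : ι → ι → ℝ) (s : ι → ℤˣ) : ℝ :=
  ∑ i ∈ B, ∑ j ∈ Bᶜ, sgn (s i) * sgn (s j) * a i j

lemma chaos_sub (B : Finset ι) (a a' : ι → ι → ℝ) (s : ι → ℤˣ) :
    chaos B a s - chaos B a' s = chaos B (fun i j => a i j - a' i j) s := by
  simp only [chaos, ← Finset.sum_sub_distrib, mul_sub]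

/-- Given the signs outside `B`, the chaos is a Rademacher sum with coefficients `Y i`, so its
exponential moment is at most that of `∑ (Y i)² / (8 D²)`. Jensen's inequality with weights
proportional to the row norms `r i` separates the rows, and each row is the square of one Rademacher
sum. -/
lemma sum_exp_chaos_le (B : Finset ι) (a : ι → ι → ℝ) {D : ℝ} (hD : 0 < D)
    (h : ∑ i ∈ B, ∑ j ∈ Bᶜ, a i j ^ 2 ≤ D ^ 2) :
    ∑ s : ι → ℤˣ, Real.exp (chaos B a s / (2 * D)) ≤ 2 * Fintype.card (ι → ℤˣ) := by
  set r : ι → ℝ := fun i => ∑ j ∈ Bᶜ, a i j ^ 2 with hr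
  have hr0 : ∀ i, 0 ≤ r i := fun i => Finset.sum_nonneg fun j _ => sq_nonneg _
  set Y : ι → (ι → ℤˣ) → ℝ := fun i s => ∑ j ∈ Bᶜ, sgn (s j) * a i j with hY
  have hY0 : ∀ i s, r i = 0 → Y i s = 0 := by
    intro i s hi
    refine Finset.sum_eq_zero fun j hj => ?_
    have := (Finset.sum_eq_zero_iff_of_nonneg (fun j _ => sq_nonneg (a i j))).1 hi j hj
    simp [pow_eq_zero_iff] at this
    simp [this]
  rcases eq_or_lt_of_le (Finset.sum_nonneg fun i (_ : i ∈ B) => hr0 i) with h0 | hV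
  · have : ∀ s, chaos B a s = 0 := by
      intro s
      refine Finset.sum_eq_zero fun i hi => ?_
      have h1 := (Finset.sum_eq_zero_iff_of_nonneg (fun i _ => hr0 i)).1 h0.symm i hi
      have h2 := hY0 i s h1
      simp only [mul_assoc, ← Finset.mul_sum]
      rw [show ∑ j ∈ Bᶜ, sgn (s j) * a i j = 0 from h2, mul_zero]
    simp only [this, zero_div, Real.exp_zero, Finset.sum_const, Finset.card_univ, nsmul_eq_mul,
      mul_one]
    have : (0 : ℝ) ≤ Fintype.card (ι → ℤˣ) := by positivity
    linarith
  set V := ∑ i ∈ B, r i with hVdef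
  have step1 : ∑ s : ι → ℤˣ, Real.exp (chaos B a s / (2 * D))
      ≤ ∑ s : ι → ℤˣ, Real.exp (∑ i ∈ B, (Y i s / (2 * D)) ^ 2 / 2) := by
    have := sum_exp_linear_le B (fun i s => Y i s / (2 * D)) ?_ (fun _ => 0) (by simp)
    · simp only [add_zero] at this
      refine le_trans (le_of_eq (Finset.sum_congr rfl fun s _ => ?_)) this
      congr 1
      rw [chaos, Finset.sum_div]
      refine Finset.sum_congr rfl fun i _ => ?_
      rw [← mul_div_assoc, hY]
      simp only [Finset.mul_sum, mul_assoc]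
    · intro b hb i _ s
      simp only [hY]
      congr 1
      refine Finset.sum_congr rfl fun j hj => ?_
      rw [flip_ne]
      rintro rfl
      simp at hj; exact hj hb
  refine step1.trans ?_
  have hrow : ∀ i ∈ B, (r i / V) * ∑ s : ι → ℤˣ, Real.exp ((Y i s / (2 * D)) ^ 2 / 2 / (r i / V))
      ≤ (r i / V) * (2 * Fintype.card (ι → ℤˣ)) := by
    intro i _
    rcases eq_or_lt_of_le (hr0 i) with hi | hi
    · simp [← hi]
    gcongr
    -- After division by the weight `r i / V`, the exponent is `t (Y i)²` with this `t`. Since `V ≤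
    -- D²`, the product `t * r i` is at most `1/8` for every row, well within the range of
    -- `sum_exp_sq_le`.
    have ht : 0 ≤ V / (8 * D ^ 2 * r i) := by positivity
    have e1 : V / (8 * D ^ 2 * r i) * r i = V / (8 * D ^ 2) := by field_simp
    have e2 : V / (8 * D ^ 2) ≤ 1 / 8 := by rw [div_le_div_iff₀ (by positivity) (by norm_num)]; linarith
    have := sum_exp_sq_le Bᶜ (a i) 0 (V / (8 * D ^ 2 * r i)) ht
      (by change 2 * _ * r i < 1; nlinarith)
    calc _ = ∑ s : ι → ℤˣ, Real.exp (V / (8 * D ^ 2 * r i) * (0 + ∑ j ∈ Bᶜ, sgn (s j) * a i j) ^ 2) := by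
          refine Finset.sum_congr rfl fun s _ => ?_
          congr 1
          rw [zero_add]
          change _ = V / (8 * D ^ 2 * r i) * Y i s ^ 2
          field_simp
          norm_num
      _ ≤ _ := this
      _ ≤ Fintype.card (ι → ℤˣ) * 2 := by
          gcongr
          change Real.exp ((0 ^ 2 + r i) * (V / (8 * D ^ 2 * r i) / (1 - 2 * (V / (8 * D ^ 2 * r i)) * r i))) ≤ 2
          rw [mul_assoc 2, e1, zero_pow two_ne_zero, zero_add, mul_div_assoc', mul_comm (r i), e1]
          have hx : V / (8 * D ^ 2) / (1 - 2 * (V / (8 * D ^ 2))) ≤ 1 / 2 := by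
            rw [div_le_div_iff₀ (by linarith) (by norm_num)]; linarith
          have h4 : Real.exp (1 / 2) ≤ 2 := by
            have := Real.exp_one_lt_d9
            have h5 : Real.exp (1 / 2) ^ 2 = Real.exp 1 := by rw [← Real.exp_nat_mul]; norm_num
            nlinarith [Real.exp_pos (1 / 2)]
          exact (Real.exp_le_exp.2 hx).trans h4
      _ = _ := mul_comm _ _
  have hw : ∑ i ∈ B, r i / V = 1 := by rw [← Finset.sum_div]; exact div_self hV.ne'
  calc ∑ s : ι → ℤˣ, Real.exp (∑ i ∈ B, (Y i s / (2 * D)) ^ 2 / 2)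
      ≤ ∑ s : ι → ℤˣ, ∑ i ∈ B, (r i / V) * Real.exp ((Y i s / (2 * D)) ^ 2 / 2 / (r i / V)) := by
        refine Finset.sum_le_sum fun s _ => ?_
        have := convexOn_exp.map_sum_le (t := B) (w := fun i => r i / V)
          (p := fun i => (Y i s / (2 * D)) ^ 2 / 2 / (r i / V))
          (fun i _ => div_nonneg (hr0 i) hV.le) hw (fun _ _ => Set.mem_univ _)
        simp only [smul_eq_mul] at this
        refine le_trans (le_of_eq ?_) this
        congr 1
        refine Finset.sum_congr rfl fun i _ => ?_
        -- A zero row has weight `0` and `Y i = 0`, so division by zero does no harm.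
        rcases eq_or_lt_of_le (hr0 i) with hi | hi
        · simp [hY0 i s hi.symm]
        · field_simp
    _ = ∑ i ∈ B, (r i / V) * ∑ s : ι → ℤˣ, Real.exp ((Y i s / (2 * D)) ^ 2 / 2 / (r i / V)) := by
        rw [Finset.sum_comm]; simp only [Finset.mul_sum]
    _ ≤ ∑ i ∈ B, (r i / V) * (2 * Fintype.card (ι → ℤˣ)) := Finset.sum_le_sum hrow
    _ = _ := by rw [← Finset.sum_mul, hw, one_mul]

/-- A decoupled Rademacher chaos is subexponential. -/
lemma sum_exp_abs_chaos_le (B : Finset ι) (a : ι → ι → ℝ) {D : ℝ} (hD : 0 < D)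
    (h : ∑ i ∈ B, ∑ j ∈ Bᶜ, a i j ^ 2 ≤ D ^ 2) :
    ∑ s : ι → ℤˣ, Real.exp (|chaos B a s| / (2 * D)) ≤ 4 * Fintype.card (ι → ℤˣ) := by
  have h1 := sum_exp_chaos_le B a hD h
  have h2 := sum_exp_chaos_le B (fun i j => -a i j) hD (by simpa using h)
  calc ∑ s : ι → ℤˣ, Real.exp (|chaos B a s| / (2 * D))
      ≤ ∑ s : ι → ℤˣ, (Real.exp (chaos B a s / (2 * D)) +
          Real.exp (chaos B (fun i j => -a i j) s / (2 * D))) := by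
        refine Finset.sum_le_sum fun s _ => ?_
        have hn : chaos B (fun i j => -a i j) s = -chaos B a s := by simp [chaos]
        rw [hn]
        rcases abs_choice (chaos B a s) with h | h <;> rw [h] <;>
          simp [Real.exp_nonneg]
    _ ≤ _ := by rw [Finset.sum_add_distrib]; linarith

/-- A crude deterministic bound, needed only for the remainder after the last net of the chain,
which tends to zero, and for coefficients that vanish on the block. -/
lemma abs_chaos_le (B : Finset ι) (a : ι → ι → ℝ) (s : ι → ℤˣ) {D : ℝ} (hD : 0 ≤ D)
    (h : ∑ i ∈ B, ∑ j ∈ Bᶜ, a i j ^ 2 ≤ D ^ 2) :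
    |chaos B a s| ≤ Fintype.card ι ^ 2 * D := by
  have hij : ∀ i ∈ B, ∀ j ∈ Bᶜ, |a i j| ≤ D := fun i hi j hj => by
    refine abs_le_of_sq_le_sq ?_ hD
    refine le_trans ?_ h
    refine le_trans ?_ (Finset.single_le_sum (f := fun i => ∑ j ∈ Bᶜ, a i j ^ 2)
      (fun i _ => Finset.sum_nonneg fun j _ => sq_nonneg _) hi)
    exact Finset.single_le_sum (f := fun j => a i j ^ 2) (fun j _ => sq_nonneg _) hj
  calc |chaos B a s| ≤ ∑ i ∈ B, ∑ j ∈ Bᶜ, D := by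
        refine (Finset.abs_sum_le_sum_abs _ _).trans (Finset.sum_le_sum fun i hi => ?_)
        refine (Finset.abs_sum_le_sum_abs _ _).trans (Finset.sum_le_sum fun j hj => ?_)
        rw [abs_mul, abs_mul, abs_sgn, abs_sgn, one_mul, one_mul]
        exact hij i hi j hj
    _ ≤ ∑ i : ι, ∑ j : ι, D := by
        refine (Finset.sum_le_sum fun i _ => Finset.sum_le_sum_of_subset_of_nonneg
          (Finset.subset_univ _) fun _ _ _ => hD).trans ?_
        exact Finset.sum_le_sum_of_subset_of_nonneg (Finset.subset_univ _)
          fun _ _ _ => Finset.sum_nonneg fun _ _ => hD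
    _ = _ := by simp; ring

end Chaos

/-! ### Maximal inequality and chaining -/

section Chaining

variable {τ S : Type*} [Fintype S]

/-- A maximal inequality for finitely many subexponential variables. -/
lemma exists_majorant (T : Finset τ) (hT : T.Nonempty) (Y : τ → S → ℝ) {D : ℝ} (hD : 0 < D)
    (hY : ∀ g ∈ T, ∑ s, Real.exp (|Y g s| / D) ≤ 4 * Fintype.card S) :
    ∃ V : S → ℝ, (∀ g ∈ T, ∀ s, |Y g s| ≤ V s) ∧
      ∑ s, V s ≤ Fintype.card S * (D * (Real.log T.card + 4)) := by
  have hN : (0 : ℝ) < T.card := by exact_mod_cast hT.card_pos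
  -- This is `x ≤ exp x` at `x = |Y g s| / D - log N`, with one exponential replaced by the sum over
  -- `T`. The average over `s` of the last summand is at most `4`.
  refine ⟨fun s => D * (Real.log T.card + (∑ g ∈ T, Real.exp (|Y g s| / D)) / T.card),
    fun g hg s => ?_, ?_⟩
  · have h1 : |Y g s| / D - Real.log T.card ≤ Real.exp (|Y g s| / D - Real.log T.card) := by
      linarith [Real.add_one_le_exp (|Y g s| / D - Real.log T.card)]
    rw [Real.exp_sub, Real.exp_log hN] at h1
    have h2 : Real.exp (|Y g s| / D) ≤ ∑ g ∈ T, Real.exp (|Y g s| / D) :=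
      Finset.single_le_sum (f := fun g => Real.exp (|Y g s| / D))
        (fun _ _ => Real.exp_nonneg _) hg
    have h3 := div_le_div_of_nonneg_right h2 hN.le
    have h4 : |Y g s| / D ≤ Real.log T.card + (∑ g ∈ T, Real.exp (|Y g s| / D)) / T.card := by
      linarith
    rwa [div_le_iff₀' hD] at h4
  · rw [← Finset.mul_sum, Finset.sum_add_distrib, ← Finset.sum_div, Finset.sum_comm]
    have h1 : ∑ g ∈ T, ∑ s, Real.exp (|Y g s| / D) ≤ T.card * (4 * Fintype.card S) := by
      refine (Finset.sum_le_sum hY).trans (le_of_eq ?_)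
      simp
    have h2 : (∑ g ∈ T, ∑ s, Real.exp (|Y g s| / D)) / T.card ≤ 4 * Fintype.card S := by
      rw [div_le_iff₀ hN]; linarith
    simp only [Finset.sum_const, Finset.card_univ, nsmul_eq_mul]
    calc _ ≤ D * (Fintype.card S * Real.log T.card + 4 * Fintype.card S) := by gcongr
      _ = _ := by ring

/-- Chaining along a sequence of finite nets. -/
lemma exists_majorant_chain (Z : τ → S → ℝ) (d : τ → τ → ℝ) {D₀ : ℝ} (hD₀ : 0 < D₀)
    (T : ℕ → Finset τ) (hT : ∀ k, (T k).Nonempty)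
    (hnet : ∀ k, ∀ g ∈ T (k + 1), ∃ h ∈ T k, d g h ≤ D₀ * (1 / 2) ^ (k + 1))
    (hZ₀ : ∀ g ∈ T 0, ∑ s, Real.exp (|Z g s| / D₀) ≤ 4 * Fintype.card S)
    (hZ : ∀ k, ∀ g ∈ T (k + 1), ∀ h ∈ T k, ∀ D > 0, d g h ≤ D →
      ∑ s, Real.exp (|Z g s - Z h s| / D) ≤ 4 * Fintype.card S) (K : ℕ) :
    ∃ V : S → ℝ, (∀ g ∈ T K, ∀ s, |Z g s| ≤ V s) ∧
      ∑ s, V s ≤ Fintype.card S *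
        ∑ k ∈ Finset.range (K + 1), D₀ * (1 / 2) ^ k * (Real.log (T k).card + 4) := by
  induction K with
  | zero => simpa using exists_majorant (T 0) (hT 0) Z hD₀ hZ₀
  | succ K ih =>
    obtain ⟨V, hV, hVs⟩ := ih
    -- Each element has a single parent in the preceding net, so the increments number at most `(T
    -- (K + 1)).card`. The nets need not be nested.
    choose! p hpT hpd using hnet K
    obtain ⟨W, hW, hWs⟩ := exists_majorant (T (K + 1)) (hT _) (fun g s => Z g s - Z (p g) s)
      (D := D₀ * (1 / 2) ^ (K + 1)) (by positivity)
      fun g hg => hZ K g hg _ (hpT g hg) _ (by positivity) (hpd g hg)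
    refine ⟨fun s => V s + W s, fun g hg s => ?_, ?_⟩
    · have h1 := hV _ (hpT g hg) s
      have h2 := hW g hg s
      calc |Z g s| = |Z (p g) s + (Z g s - Z (p g) s)| := by congr 1; ring
        _ ≤ _ := (abs_add_le _ _).trans (add_le_add h1 h2)
    · rw [Finset.sum_add_distrib, Finset.sum_range_succ, mul_add]
      exact add_le_add hVs hWs

end Chaining

/-! ### Integrals of nonincreasing functions -/

section Integrals

/-- Dyadic lower bound for the integral of a nonincreasing function. -/
lemma sum_dyadic_le_lintegral {g : ℝ → ℝ≥0∞} (hg : Antitone g) {θ : ℝ} (hθ : 0 ≤ θ) (K : ℕ) :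
    ∑ k ∈ Finset.range K, ENNReal.ofReal (θ * (1 / 2) ^ k) * g (θ * (1 / 2) ^ k)
      ≤ 2 * ∫⁻ η in Set.Ioc 0 θ, g η := by
  -- Keeping the integral over the part not yet used makes the induction close: the term at `u` is
  -- charged to `(u/2, u]`, whose length `u/2` accounts for the factor `2`.
  suffices h : ∑ k ∈ Finset.range K, ENNReal.ofReal (θ * (1 / 2) ^ k) * g (θ * (1 / 2) ^ k)
      + 2 * ∫⁻ η in Set.Ioc 0 (θ * (1 / 2) ^ K), g η ≤ 2 * ∫⁻ η in Set.Ioc 0 θ, g η from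
    le_trans le_self_add h
  induction K with
  | zero => simp
  | succ K ih =>
    refine le_trans ?_ ih
    rw [Finset.sum_range_succ, add_assoc]
    gcongr
    set u := θ * (1 / 2) ^ K with hu
    have hu0 : 0 ≤ u := by positivity
    have hu' : θ * (1 / 2) ^ (K + 1) = u / 2 := by rw [hu, pow_succ]; ring
    rw [hu', ← Set.Ioc_union_Ioc_eq_Ioc (a := (0 : ℝ)) (b := u / 2) (c := u) (by linarith)
      (by linarith), lintegral_union measurableSet_Ioc (by
        rw [Set.disjoint_left]; intro x hx hx'; exact absurd hx.2 (not_le.2 hx'.1)), mul_add,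
      add_comm]
    refine add_le_add le_rfl ?_
    calc ENNReal.ofReal u * g u = 2 * ∫⁻ η in Set.Ioc (u / 2) u, g u := by
          rw [setLIntegral_const, Real.volume_Ioc, mul_comm (g u), ← mul_assoc]
          congr 1
          rw [show (2 : ℝ≥0∞) = ENNReal.ofReal 2 by simp, ← ENNReal.ofReal_mul (by norm_num)]
          congr 1; ring
      _ ≤ _ := by
          gcongr 2 * ?_
          exact setLIntegral_mono' measurableSet_Ioc fun η hη => hg hη.2

/-- Sublinear growth of the integral of a nonincreasing function. -/
lemma lintegral_Ioc_le_of_antitone {g : ℝ → ℝ≥0∞} (hg : Antitone g) {a δ : ℝ} (ha : 0 < a)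
    (hδ : 0 ≤ δ) :
    ∫⁻ η in Set.Ioc 0 δ, g η ≤ (1 + ENNReal.ofReal (δ / a)) * ∫⁻ η in Set.Ioc 0 a, g η := by
  rcases le_total δ a with h | h
  · calc _ ≤ ∫⁻ η in Set.Ioc 0 a, g η := lintegral_mono_set (Set.Ioc_subset_Ioc_right h)
      _ ≤ _ := le_mul_of_one_le_left' (by simp)
  · rw [← Set.Ioc_union_Ioc_eq_Ioc ha.le h, lintegral_union measurableSet_Ioc (by
        rw [Set.disjoint_left]; intro x hx hx'; exact absurd hx.2 (not_le.2 hx'.1)), add_mul,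
        one_mul]
    gcongr
    have h1 : ENNReal.ofReal a * g a ≤ ∫⁻ η in Set.Ioc 0 a, g η := by
      calc _ = ∫⁻ η in Set.Ioc 0 a, g a := by simp [mul_comm]
        _ ≤ _ := setLIntegral_mono' measurableSet_Ioc fun η hη => hg hη.2
    calc ∫⁻ η in Set.Ioc a δ, g η ≤ ∫⁻ η in Set.Ioc a δ, g a :=
          setLIntegral_mono' measurableSet_Ioc fun η hη => hg hη.1.le
      _ = ENNReal.ofReal (δ - a) * g a := by simp [mul_comm]
      _ ≤ ENNReal.ofReal (δ / a) * (ENNReal.ofReal a * g a) := by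
          rw [← mul_assoc, ← ENNReal.ofReal_mul (by positivity), div_mul_cancel₀ _ ha.ne']
          gcongr; linarith
      _ ≤ _ := by gcongr

end Integrals

/-! ### Covering numbers and the empirical norm -/

section Covering

variable {χ : Type*} {n : ℕ}

lemma log_le_entropy {η : ℝ} {𝓕 : Set (Kernels n χ)} {Q : DiscreteMeasure n χ} {m : ℕ}
    (hm : 1 ≤ m) (h : (m : ℕ∞) ≤ coveringNumber η 𝓕 Q) :
    ENNReal.ofReal (Real.log m) ≤ entropy η 𝓕 Q := by
  have h1 : ((m : ℕ∞) : ℝ≥0∞) ≤ (coveringNumber η 𝓕 Q : ℝ≥0∞) := ENat.toENNReal_mono h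
  have h2 : ENNReal.log ((m : ℕ∞) : ℝ≥0∞) = (Real.log m : ℝ) := by
    have : ((m : ℕ∞) : ℝ≥0∞) = ENNReal.ofReal m := by simp
    rw [this, ENNReal.log_ofReal_of_pos (by exact_mod_cast hm)]
  have h3 := EReal.toENNReal_le_toENNReal (ENNReal.log_le_log h1)
  rw [h2] at h3
  exact le_trans (le_of_eq (by simp)) h3

lemma entropy_eq_top {η : ℝ} {𝓕 : Set (Kernels n χ)} {Q : DiscreteMeasure n χ}
    (h : coveringNumber η 𝓕 Q = ⊤) : entropy η 𝓕 Q = ⊤ := by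
  simp [entropy, h]

lemma coveringNumber_antitone (𝓕 : Set (Kernels n χ)) (Q : DiscreteMeasure n χ) :
    Antitone fun η => coveringNumber η 𝓕 Q := by
  intro η η' h
  refine le_iInf fun S => le_iInf fun hS => le_iInf fun hS' => ?_
  exact iInf_le_of_le S (iInf_le_of_le hS (iInf_le_of_le
    (fun f hf => (hS' f hf).imp fun g hg => ⟨hg.1, hg.2.trans h⟩) le_rfl))

lemma entropy_antitone (𝓕 : Set (Kernels n χ)) (Q : DiscreteMeasure n χ) :
    Antitone fun η => entropy η 𝓕 Q := fun _ _ h =>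
  EReal.toENNReal_le_toENNReal (ENNReal.log_le_log
    (ENat.toENNReal_mono (coveringNumber_antitone 𝓕 Q h)))

lemma exists_net {η : ℝ} {𝓕 : Set (Kernels n χ)} {Q : DiscreteMeasure n χ} {m : ℕ∞}
    (h : coveringNumber η 𝓕 Q < m) : ∃ S : Finset (Kernels n χ), (S : Set (Kernels n χ)) ⊆ 𝓕 ∧
      (∀ f ∈ 𝓕, ∃ g ∈ S, normQ Q (f - g) ≤ η) ∧ (S.card : ℕ∞) < m := by
  simp only [coveringNumber, iInf_lt_iff] at h
  obtain ⟨S, h1, h2, h3⟩ := h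
  exact ⟨S, h1, h2, h3⟩

/-- Finite entropy makes the covering number a natural number `N`; a net with fewer than `N + 1`
elements then attains the infimum. -/
lemma exists_net_card_le_entropy {η : ℝ} {𝓕 : Set (Kernels n χ)} {Q : DiscreteMeasure n χ}
    (hne : 𝓕.Nonempty) (h : entropy η 𝓕 Q ≠ ⊤) : ∃ S : Finset (Kernels n χ), S.Nonempty ∧
      (S : Set (Kernels n χ)) ⊆ 𝓕 ∧ (∀ f ∈ 𝓕, ∃ g ∈ S, normQ Q (f - g) ≤ η) ∧
      ENNReal.ofReal (Real.log S.card) ≤ entropy η 𝓕 Q := by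
  have hN : coveringNumber η 𝓕 Q ≠ ⊤ := fun h' => h (entropy_eq_top h')
  obtain ⟨S, h1, h2, h3⟩ := exists_net (m := coveringNumber η 𝓕 Q + 1)
    ((ENat.lt_add_one_iff hN).2 le_rfl)
  obtain ⟨f, hf⟩ := hne
  obtain ⟨g, hg, -⟩ := h2 f hf
  exact ⟨S, ⟨g, hg⟩, h1, h2, log_le_entropy (Finset.card_pos.2 ⟨g, hg⟩)
    ((ENat.lt_add_one_iff hN).1 h3)⟩

/-- A class that contains zero and an element of norm more than `2 η` cannot be covered by
one ball of radius `η`. -/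
lemma log_two_le_entropy {η : ℝ} {𝓕 : Set (Kernels n χ)} {Q : DiscreteMeasure n χ}
    (h0 : 0 ∈ 𝓕) (htri : ∀ f g : Kernels n χ, normQ Q f ≤ normQ Q (f - g) + normQ Q (0 - g))
    {f : Kernels n χ} (hf : f ∈ 𝓕) (hη : 2 * η < normQ Q f) :
    ENNReal.ofReal (Real.log 2) ≤ entropy η 𝓕 Q := by
  refine le_trans (le_of_eq (by norm_num)) (log_le_entropy (m := 2) (by norm_num) ?_)
  -- A net with one element `g` would have both `f` and `0` within `η` of `g`, against `2 * η <
  -- normQ Q f`.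
  by_contra! hlt
  obtain ⟨S, -, h2, h3⟩ := exists_net hlt
  have hc : S.card ≤ 1 := by
    have : S.card < 2 := by exact_mod_cast h3
    omega
  obtain ⟨g, hg, hg'⟩ := h2 f hf
  obtain ⟨g', hg₁, hg₁'⟩ := h2 0 h0
  rw [Finset.card_le_one.1 hc g' hg₁ g hg] at hg₁'
  linarith [htri f g]

/-- The empirical measure of a sample. -/
noncomputable def empirical (hn : 2 ≤ n) (x : Fin n → χ) : DiscreteMeasure n χ where
  t := n
  two_le := hn
  le_n := le_rfl
  z := x
  q := fun _ => 1 / n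
  q_pos := fun _ => by
    have : (0 : ℝ) < n := by exact_mod_cast (by omega : 0 < n)
    positivity
  q_sum := by
    have : (n : ℝ) ≠ 0 := by exact_mod_cast (by omega : n ≠ 0)
    simp [this]

lemma numPairs_pos (hn : 2 ≤ n) : 0 < numPairs n := by
  have : (2 : ℝ) ≤ n := by exact_mod_cast hn
  unfold numPairs
  nlinarith

lemma card_pairs (n : ℕ) : ((pairs n).card : ℝ) = numPairs n := by
  have h : (pairs n) = (Finset.univ : Finset (Fin n)).offDiag := by
    ext p; simp [pairs, Finset.mem_offDiag]
  rw [h, Finset.offDiag_card, Finset.card_univ, Fintype.card_fin, numPairs,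
    Nat.cast_sub (Nat.le_mul_self n)]
  push_cast; ring

lemma normQ_nonneg (Q : DiscreteMeasure n χ) (f : Kernels n χ) : 0 ≤ normQ Q f :=
  Real.sqrt_nonneg _

lemma normQ_empirical_sq (hn : 2 ≤ n) (x : Fin n → χ) (f : Kernels n χ) :
    normQ (empirical hn x) f ^ 2 =
      (∑ p ∈ pairs n, f p.1 p.2 (x p.1) (x p.2) ^ 2) / numPairs n := by
  have hn0 : (0 : ℝ) < n := by exact_mod_cast (by omega : 0 < n)
  have hN := numPairs_pos hn
  have : normQ (empirical hn x) f =
      Real.sqrt ((∑ p ∈ pairs n, f p.1 p.2 (x p.1) (x p.2) ^ 2) / numPairs n) := by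
    unfold normQ
    congr 1
    change (∑ p ∈ pairs n, f p.1 p.2 (x p.1) (x p.2) ^ 2 * ((1 / n : ℝ) * (1 / n))) /
      (∑ p ∈ pairs n, (1 / n : ℝ) * (1 / n)) = _
    rw [← Finset.sum_mul, Finset.sum_const, nsmul_eq_mul, card_pairs]
    field_simp
  rw [this, Real.sq_sqrt]
  exact div_nonneg (Finset.sum_nonneg fun _ _ => sq_nonneg _) hN.le

/-- Minkowski's inequality for `f = (f - g) - (0 - g)`, by Cauchy–Schwarz over the pairs. This form
matches the distances from a centre `g` to `f` and to `0`. -/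
lemma normQ_empirical_triangle (hn : 2 ≤ n) (x : Fin n → χ) (f g : Kernels n χ) :
    normQ (empirical hn x) f ≤
      normQ (empirical hn x) (f - g) + normQ (empirical hn x) (0 - g) := by
  have hN := numPairs_pos hn
  set u := normQ (empirical hn x) (f - g) with hu
  set v := normQ (empirical hn x) (0 - g) with hv
  have hu0 : 0 ≤ u := normQ_nonneg _ _
  have hv0 : 0 ≤ v := normQ_nonneg _ _
  have h1 := normQ_empirical_sq hn x (f - g)
  have h2 := normQ_empirical_sq hn x (0 - g)
  rw [← hu, eq_div_iff hN.ne'] at h1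
  rw [← hv, eq_div_iff hN.ne'] at h2
  refine abs_le_of_sq_le_sq' ?_ (by positivity) |>.2
  rw [normQ_empirical_sq, div_le_iff₀ hN]
  set α : Fin n × Fin n → ℝ := fun p => (f - g) p.1 p.2 (x p.1) (x p.2)
  set β : Fin n × Fin n → ℝ := fun p => (0 - g) p.1 p.2 (x p.1) (x p.2)
  have hcs : (∑ p ∈ pairs n, α p * β p) ^ 2 ≤ (∑ p ∈ pairs n, α p ^ 2) * ∑ p ∈ pairs n, β p ^ 2 :=
    Finset.sum_mul_sq_le_sq_mul_sq _ _ _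
  rw [← h1, ← h2] at hcs
  have h3 : |∑ p ∈ pairs n, α p * β p| ≤ u * v * numPairs n := by
    refine abs_le_of_sq_le_sq ?_ (by positivity)
    refine hcs.trans (le_of_eq ?_); ring
  have h4 : ∑ p ∈ pairs n, f p.1 p.2 (x p.1) (x p.2) ^ 2 = ∑ p ∈ pairs n, α p ^ 2 +
      ∑ p ∈ pairs n, β p ^ 2 - 2 * ∑ p ∈ pairs n, α p * β p := by
    rw [Finset.mul_sum, ← Finset.sum_add_distrib, ← Finset.sum_sub_distrib]
    refine Finset.sum_congr rfl fun p _ => ?_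
    simp only [α, β, Pi.sub_apply, Pi.zero_apply]; ring
  have h5 := (abs_le.1 h3).1
  rw [h4, ← h1, ← h2]
  nlinarith

lemma normQ_empirical_mono (hn : 2 ≤ n) (x : Fin n → χ) {f F : Kernels n χ}
    (h : ∀ i j, i ≠ j → |f i j (x i) (x j)| ≤ F i j (x i) (x j)) :
    normQ (empirical hn x) f ≤ normQ (empirical hn x) F := by
  have hN := numPairs_pos hn
  refine abs_le_of_sq_le_sq' ?_ (normQ_nonneg _ _) |>.2
  rw [normQ_empirical_sq, normQ_empirical_sq]
  refine div_le_div_of_nonneg_right (Finset.sum_le_sum fun p hp => ?_) hN.le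
  have hp' : p.1 ≠ p.2 := by simpa [pairs] using hp
  exact sq_le_sq' (abs_le.1 (h _ _ hp')).1 (abs_le.1 (h _ _ hp')).2

lemma sum_block_le_sum_pairs (B : Finset (Fin n)) (u : Fin n → Fin n → ℝ)
    (hu : ∀ i j, 0 ≤ u i j) :
    ∑ i ∈ B, ∑ j ∈ Bᶜ, u i j ≤ ∑ p ∈ pairs n, u p.1 p.2 := by
  have hp : ∑ i ∈ B, ∑ j ∈ Bᶜ, u i j = ∑ p ∈ B ×ˢ Bᶜ, u p.1 p.2 :=
    (Finset.sum_product B Bᶜ fun p => u p.1 p.2).symm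
  rw [hp]
  refine Finset.sum_le_sum_of_subset_of_nonneg ?_ fun _ _ _ => hu _ _
  intro p hp
  simp only [Finset.mem_product, Finset.mem_compl] at hp
  simp only [pairs, Finset.mem_filter, Finset.mem_univ, true_and]
  rintro h
  exact hp.2 (h ▸ hp.1)

lemma ne_of_mem_block {B : Finset (Fin n)} {i j : Fin n} (hi : i ∈ B) (hj : j ∈ Bᶜ) : i ≠ j := by
  rintro rfl
  simp at hj; exact hj hi

/-- The `ℓ²` norm of a block of an array that is dominated by a kernel. -/
lemma sum_block_sq_le (hn : 2 ≤ n) (x : Fin n → χ) (B : Finset (Fin n)) (a : Fin n → Fin n → ℝ)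
    (f : Kernels n χ) {L r : ℝ}
    (h : ∀ i j, i ≠ j → |a i j| ≤ L * |f i j (x i) (x j)|)
    (hr : normQ (empirical hn x) f ≤ r) :
    ∑ i ∈ B, ∑ j ∈ Bᶜ, a i j ^ 2 ≤ (L * Real.sqrt (numPairs n) * r) ^ 2 := by
  have hN := numPairs_pos hn
  calc ∑ i ∈ B, ∑ j ∈ Bᶜ, a i j ^ 2
      ≤ ∑ i ∈ B, ∑ j ∈ Bᶜ, L ^ 2 * f i j (x i) (x j) ^ 2 := by
        refine Finset.sum_le_sum fun i hi => Finset.sum_le_sum fun j hj => ?_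
        rw [← sq_abs (a i j), ← sq_abs (f _ _ _ _), ← mul_pow]
        exact pow_le_pow_left₀ (abs_nonneg _) (h i j (ne_of_mem_block hi hj)) 2
    _ ≤ ∑ p ∈ pairs n, L ^ 2 * f p.1 p.2 (x p.1) (x p.2) ^ 2 :=
        sum_block_le_sum_pairs B (fun i j => L ^ 2 * f i j (x i) (x j) ^ 2)
          fun _ _ => by positivity
    _ = L ^ 2 * (numPairs n * normQ (empirical hn x) f ^ 2) := by
        rw [normQ_empirical_sq, mul_div_cancel₀ _ hN.ne', Finset.mul_sum]
    _ ≤ L ^ 2 * (numPairs n * r ^ 2) := by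
        have := normQ_nonneg (empirical hn x) f
        gcongr
    _ = _ := by rw [mul_pow, mul_pow, Real.sq_sqrt hN.le]; ring

end Covering

/-! ### Entropy bounds conditional on the sample -/

section Pointwise

variable {χ : Type*} {n : ℕ}

lemma antitone_add_entropy (c : ℝ≥0∞) (𝓕 : Set (Kernels n χ)) (Q : DiscreteMeasure n χ) {φ : ℝ}
    (hφ : 0 ≤ φ) : Antitone fun η => c + entropy (η * φ) 𝓕 Q := fun _ _ h =>
  add_le_add le_rfl (entropy_antitone 𝓕 Q (mul_le_mul_of_nonneg_right h hφ))

/-- Entropy bound for the supremum of a decoupled Rademacher chaos, given the sample. -/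
lemma sum_iSup_chaos_le_lintegral (hn : 2 ≤ n) (x : Fin n → χ) (B : Finset (Fin n))
    {𝓕 : Set (Kernels n χ)} (hne : 𝓕.Nonempty) (G : Kernels n χ → Fin n → Fin n → ℝ) {L : ℝ}
    (hL : 0 < L)
    (hG : ∀ f ∈ 𝓕, ∀ g ∈ 𝓕, ∀ i j, i ≠ j →
      |G f i j - G g i j| ≤ L * |f i j (x i) (x j) - g i j (x i) (x j)|)
    (hG0 : ∀ f ∈ 𝓕, ∀ i j, i ≠ j → |G f i j| ≤ L * |f i j (x i) (x j)|)
    {θ φ : ℝ} (hθ : 0 < θ) (hφ : 0 < φ) (hσ : ∀ f ∈ 𝓕, normQ (empirical hn x) f ≤ θ * φ) :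
    ∑ s : Fin n → ℤˣ, ⨆ f ∈ 𝓕, ENNReal.ofReal |chaos B (G f) s| ≤
      Fintype.card (Fin n → ℤˣ) * (ENNReal.ofReal (32 * L * Real.sqrt (numPairs n) * φ) *
        ∫⁻ η in Set.Ioc 0 (θ / 2), (1 + entropy (η * φ) 𝓕 (empirical hn x))) := by
  set Q := empirical hn x with hQ
  set c := Real.sqrt (numPairs n) with hc
  have hc0 : 0 < c := Real.sqrt_pos.2 (numPairs_pos hn)
  set h := fun η => 1 + entropy (η * φ) 𝓕 Q with hh
  have hanti : Antitone h := antitone_add_entropy 1 𝓕 Q hφ.le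
  set I := ∫⁻ η in Set.Ioc 0 (θ / 2), h η with hI
  -- The first net already has half the radius `θ φ` of the class. The integral therefore stops at
  -- `θ / 2`, exactly the range where a class containing zero needs at least two balls.
  set u : ℕ → ℝ := fun k => θ / 2 * (1 / 2) ^ k with hu
  have hu0 : ∀ k, 0 < u k := fun k => by positivity
  have hcard : (Fintype.card (Fin n → ℤˣ) : ℝ≥0∞) ≠ 0 := by
    exact_mod_cast Fintype.card_ne_zero
  by_cases hItop : I = ⊤
  · rw [hItop, ENNReal.mul_top (by simpa using by positivity), ENNReal.mul_top hcard]
    exact le_top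
  -- Infinite entropy at a positive radius would make the integral infinite, by the dyadic lower
  -- bound.
  have hent : ∀ k, entropy (u k * φ) 𝓕 Q ≠ ⊤ := by
    intro k htop
    have h1 := sum_dyadic_le_lintegral hanti (by positivity : 0 ≤ θ / 2) (k + 1)
    have h2 : ENNReal.ofReal (u k) * h (u k) ≤ 2 * I :=
      le_trans (Finset.single_le_sum
        (f := fun k => ENNReal.ofReal (θ / 2 * (1 / 2) ^ k) * h (θ / 2 * (1 / 2) ^ k))
        (fun _ _ => zero_le) (Finset.self_mem_range_succ k)) h1
    have h3 : h (u k) = ⊤ := by simp [hh, htop]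
    rw [h3, ENNReal.mul_top (by simpa using hu0 k)] at h2
    exact ENNReal.mul_ne_top (by simp) hItop (top_le_iff.1 h2)
  choose T hTne hTsub hTnet hTcard using fun k => exists_net_card_le_entropy hne (hent k)
  have hinc : ∀ f ∈ 𝓕, ∀ g ∈ 𝓕, ∀ r, normQ Q (f - g) ≤ r →
      ∑ i ∈ B, ∑ j ∈ Bᶜ, (G f i j - G g i j) ^ 2 ≤ (L * c * r) ^ 2 := fun f hf g hg r hr =>
    sum_block_sq_le hn x B (fun i j => G f i j - G g i j) (f - g)
      (fun i j hij => hG f hf g hg i j hij) hr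
  -- `L c θ φ` bounds the `ℓ²` norm of every block; the factor `2` is the one in
  -- `sum_exp_abs_chaos_le`.
  set D₀ := 2 * (L * c * (θ * φ)) with hD₀
  have hDu : ∀ k, 2 * (L * c * (u k * φ)) = D₀ * (1 / 2) ^ (k + 1) := fun k => by
    rw [hD₀, pow_succ]; ring
  have hchain := exists_majorant_chain (S := Fin n → ℤˣ) (fun f s => chaos B (G f) s)
    (fun f g => 2 * (L * c * normQ Q (f - g))) (D₀ := D₀) (by positivity) T hTne
    (fun k g hg => by
      obtain ⟨f, hf, hfg⟩ := hTnet k g (hTsub _ hg)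
      refine ⟨f, hf, ?_⟩
      rw [← hDu]
      gcongr)
    (fun g hg => sum_exp_abs_chaos_le B (G g) (by positivity)
      (sum_block_sq_le hn x B (G g) g (hG0 g (hTsub _ hg)) (hσ g (hTsub _ hg))))
    (fun k g hg f hf D hD hgf => by
      have := sum_exp_abs_chaos_le B (fun i j => G g i j - G f i j) (D := D / 2) (by positivity)
        (by
          refine (hinc g (hTsub _ hg) f (hTsub _ hf) _ le_rfl).trans ?_
          have : 0 ≤ normQ Q (g - f) := normQ_nonneg _ _
          gcongr
          linarith)
      simpa only [chaos_sub, mul_div_cancel₀ D (two_ne_zero' ℝ)] using this)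
  have hbound : ∀ K, ∑ s : Fin n → ℤˣ, ⨆ f ∈ 𝓕, ENNReal.ofReal |chaos B (G f) s| ≤
      Fintype.card (Fin n → ℤˣ) * (ENNReal.ofReal (32 * L * c * φ) * I) +
        ENNReal.ofReal (Fintype.card (Fin n → ℤˣ) *
          ((n : ℝ) ^ 2 * (L * c * (u K * φ)))) := by
    intro K
    obtain ⟨V, hV, hVs⟩ := hchain K
    set ρ := (n : ℝ) ^ 2 * (L * c * (u K * φ)) with hρ
    have hρ0 : 0 ≤ ρ := by have := hu0 K; positivity
    have hV0 : ∀ s, 0 ≤ V s := fun s =>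
      (abs_nonneg _).trans (hV _ (hTne K).choose_spec s)
    have hsup : ∀ s, ⨆ f ∈ 𝓕, ENNReal.ofReal |chaos B (G f) s| ≤ ENNReal.ofReal (V s + ρ) := by
      intro s
      refine iSup₂_le fun f hf => ENNReal.ofReal_le_ofReal ?_
      obtain ⟨g, hg, hfg⟩ := hTnet K f hf
      have h1 := hV g hg s
      have h2 := abs_chaos_le B (fun i j => G f i j - G g i j) s
        (by have := hu0 K; positivity) (hinc f hf g (hTsub _ hg) _ hfg)
      rw [← chaos_sub, Fintype.card_fin] at h2
      have h3 := abs_add_le (chaos B (G g) s) (chaos B (G f) s - chaos B (G g) s)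
      rw [add_sub_cancel] at h3
      linarith
    have hlog : ∑ k ∈ Finset.range (K + 1), ENNReal.ofReal
        (D₀ * (1 / 2) ^ k * (Real.log (T k).card + 4)) ≤
        ENNReal.ofReal (32 * L * c * φ) * I := by
      calc _ ≤ ∑ k ∈ Finset.range (K + 1), ENNReal.ofReal (16 * L * c * φ) *
            (ENNReal.ofReal (u k) * h (u k)) := by
            refine Finset.sum_le_sum fun k _ => ?_
            have hlog0 : 0 ≤ Real.log (T k).card := Real.log_natCast_nonneg _
            have hk := hu0 k
            calc _ ≤ ENNReal.ofReal (16 * L * c * φ * (u k * (1 + Real.log (T k).card))) := by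
                  refine ENNReal.ofReal_le_ofReal ?_
                  -- With `log + 4 ≤ 4 (1 + log)` this gives `16`; the dyadic comparison doubles it
                  -- to `32`.
                  have e : D₀ * (1 / 2) ^ k = 4 * (L * c * φ * u k) := by rw [hD₀]; ring
                  rw [e]
                  have : 0 ≤ L * c * φ * u k := by positivity
                  nlinarith
              _ = ENNReal.ofReal (16 * L * c * φ) * (ENNReal.ofReal (u k) *
                    (1 + ENNReal.ofReal (Real.log (T k).card))) := by
                  rw [ENNReal.ofReal_mul (by positivity), ENNReal.ofReal_mul hk.le,
                    ENNReal.ofReal_add zero_le_one hlog0, ENNReal.ofReal_one]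
              _ ≤ _ := by
                  gcongr
                  exact add_le_add le_rfl (hTcard k)
        _ = ENNReal.ofReal (16 * L * c * φ) *
            ∑ k ∈ Finset.range (K + 1), ENNReal.ofReal (u k) * h (u k) := by rw [Finset.mul_sum]
        _ ≤ ENNReal.ofReal (16 * L * c * φ) * (2 * I) := by
            gcongr
            exact sum_dyadic_le_lintegral hanti (by positivity : 0 ≤ θ / 2) (K + 1)
        _ = _ := by
            rw [← mul_assoc]
            congr 1
            rw [show (2 : ℝ≥0∞) = ENNReal.ofReal 2 by simp, ← ENNReal.ofReal_mul (by positivity)]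
            congr 1; ring
    calc _ ≤ ∑ s : Fin n → ℤˣ, ENNReal.ofReal (V s + ρ) := Finset.sum_le_sum fun s _ => hsup s
      _ = ENNReal.ofReal (∑ s : Fin n → ℤˣ, V s + Fintype.card (Fin n → ℤˣ) * ρ) := by
          rw [← ENNReal.ofReal_sum_of_nonneg fun s _ => add_nonneg (hV0 s) hρ0,
            Finset.sum_add_distrib]
          simp only [Finset.sum_const, Finset.card_univ, nsmul_eq_mul]
      _ ≤ ENNReal.ofReal (Fintype.card (Fin n → ℤˣ) * ∑ k ∈ Finset.range (K + 1),
            D₀ * (1 / 2) ^ k * (Real.log (T k).card + 4) +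
            Fintype.card (Fin n → ℤˣ) * ρ) := ENNReal.ofReal_le_ofReal (by linarith)
      _ ≤ _ := by
          refine ENNReal.ofReal_add_le.trans ?_
          gcongr
          rw [ENNReal.ofReal_mul (by positivity), ENNReal.ofReal_natCast,
            ENNReal.ofReal_sum_of_nonneg]
          · gcongr
          · intro k _
            have : 0 ≤ Real.log (T k).card := Real.log_natCast_nonneg _
            positivity
  -- The last net misses each `f` by at most `u K * φ`, so for the fixed sample the deterministic
  -- remainder vanishes as `K → ∞`.
  refine ge_of_tendsto' (x := Filter.atTop) ?_ hbound
  have hlim : Filter.Tendsto (fun K => (Fintype.card (Fin n → ℤˣ) : ℝ) *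
      ((n : ℝ) ^ 2 * (L * c * (u K * φ)))) Filter.atTop (nhds 0) := by
    have h1 := tendsto_pow_atTop_nhds_zero_of_lt_one (r := (1 / 2 : ℝ)) (by norm_num) (by norm_num)
    have h2 := h1.const_mul ((Fintype.card (Fin n → ℤˣ) : ℝ) *
      ((n : ℝ) ^ 2 * (L * c * (θ / 2 * φ))))
    rw [mul_zero] at h2
    refine h2.congr fun K => ?_
    simp only [hu]; ring
  have h3 := (ENNReal.tendsto_ofReal hlim).const_add (Fintype.card (Fin n → ℤˣ) *
    (ENNReal.ofReal (32 * L * c * φ) * I))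
  simpa using h3

/-- Comparison of the two entropy integrals. -/
lemma lintegral_one_add_entropy_le {𝓕 : Set (Kernels n χ)} {Q : DiscreteMeasure n χ}
    {c : ℝ≥0∞} (htri : ∀ f g : Kernels n χ, normQ Q f ≤ normQ Q (f - g) + normQ Q (0 - g))
    {θ φ : ℝ} (hφ : 0 < φ)
    (hc : c = 1 ∨ c = 0 ∧ 0 ∈ 𝓕 ∧ ∀ r < θ * φ, ∃ f ∈ 𝓕, r < normQ Q f) :
    ∫⁻ η in Set.Ioc 0 (θ / 2), (1 + entropy (η * φ) 𝓕 Q) ≤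
      3 * ∫⁻ η in Set.Ioc 0 (θ / 2), (c + entropy (η * φ) 𝓕 Q) := by
  rcases hc with rfl | ⟨rfl, h0, hsup⟩
  · exact le_mul_of_one_le_left' (by norm_num)
  · rw [← lintegral_const_mul' _ _ (by simp)]
    -- Dropping the endpoint makes `2 η φ < θ φ` strict, as required to find an `f` of larger norm.
    -- Then `1 ≤ 2 log 2 ≤ 2 log N`, whence the factor `3`.
    rw [← restrict_Ioo_eq_restrict_Ioc]
    refine setLIntegral_mono' measurableSet_Ioo fun η hη => ?_
    obtain ⟨f, hf, hlt⟩ := hsup (2 * (η * φ)) (by nlinarith [hη.2])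
    have h1 := log_two_le_entropy h0 htri hf hlt
    have h2 : (1 : ℝ≥0∞) ≤ 2 * ENNReal.ofReal (Real.log 2) := by
      rw [show (2 : ℝ≥0∞) = ENNReal.ofReal 2 by simp, ← ENNReal.ofReal_mul (by norm_num),
        ENNReal.one_le_ofReal]
      linarith [Real.log_two_gt_d9]
    rw [zero_add, show (3 : ℝ≥0∞) = 2 + 1 by norm_num, add_mul, one_mul]
    gcongr
    exact h2.trans (by gcongr)

lemma J₂_ge (c : ℝ≥0∞) (F : Kernels n χ) (𝓕 : Set (Kernels n χ)) (δ : ℝ)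
    (Q : DiscreteMeasure n χ) :
    ∫⁻ η in Set.Ioc 0 δ, (c + entropy (η * normQ Q F) 𝓕 Q) ≤ J₂ c F 𝓕 δ :=
  le_iSup (fun Q : DiscreteMeasure n χ =>
    ∫⁻ η in Set.Ioc 0 δ, (c + entropy (η * normQ Q F) 𝓕 Q)) Q

/-- Bound for the supremum of a decoupled Rademacher chaos, given the sample, in terms of the
uniform entropy integral at a fixed point. -/
lemma sum_iSup_chaos_le (hn : 2 ≤ n) (x : Fin n → χ) (B : Finset (Fin n))
    {𝓕 : Set (Kernels n χ)} (hne : 𝓕.Nonempty) {F : Kernels n χ}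
    (hF : ∀ f ∈ 𝓕, ∀ i j, i ≠ j → |f i j (x i) (x j)| ≤ F i j (x i) (x j))
    (G : Kernels n χ → Fin n → Fin n → ℝ) {L : ℝ} (hL : 0 ≤ L)
    (hG : ∀ f ∈ 𝓕, ∀ g ∈ 𝓕, ∀ i j, i ≠ j →
      |G f i j - G g i j| ≤ L * |f i j (x i) (x j) - g i j (x i) (x j)|)
    (hG0 : ∀ f ∈ 𝓕, ∀ i j, i ≠ j → |G f i j| ≤ L * |f i j (x i) (x j)|)
    {c : ℝ≥0∞} (hc : c = 1 ∨ c = 0 ∧ 0 ∈ 𝓕) {a : ℝ} (ha : 0 < a) :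
    ∑ s : Fin n → ℤˣ, ⨆ f ∈ 𝓕, ENNReal.ofReal |chaos B (G f) s| ≤
      Fintype.card (Fin n → ℤˣ) * (ENNReal.ofReal (96 * L * Real.sqrt (numPairs n)) *
        J₂ c F 𝓕 a * (ENNReal.ofReal (normQ (empirical hn x) F) +
          (⨆ f ∈ 𝓕, ENNReal.ofReal (normQ (empirical hn x) f)) / ENNReal.ofReal a)) := by
  set Q := empirical hn x with hQ
  set φ := normQ Q F with hφ
  have hφ0 : 0 ≤ φ := normQ_nonneg _ _
  set w := Real.sqrt (numPairs n) with hw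
  have hw0 : 0 ≤ w := Real.sqrt_nonneg _
  have hle : ⨆ f ∈ 𝓕, ENNReal.ofReal (normQ Q f) ≤ ENNReal.ofReal φ :=
    iSup₂_le fun f hf => ENNReal.ofReal_le_ofReal (normQ_empirical_mono hn x (hF f hf))
  set S := ⨆ f ∈ 𝓕, ENNReal.ofReal (normQ Q f) with hS
  have hStop : S ≠ ⊤ := ne_top_of_le_ne_top ENNReal.ofReal_ne_top hle
  set σ := S.toReal with hσ
  have hSσ : S = ENNReal.ofReal σ := (ENNReal.ofReal_toReal hStop).symm
  have hσ0 : 0 ≤ σ := ENNReal.toReal_nonneg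
  have hfσ : ∀ f ∈ 𝓕, normQ Q f ≤ σ := fun f hf => by
    rw [← ENNReal.ofReal_le_ofReal_iff hσ0, ← hSσ]
    exact le_iSup₂ (f := fun f (_ : f ∈ 𝓕) => ENNReal.ofReal (normQ Q f)) f hf
  have hσφ : σ ≤ φ := by
    rwa [hSσ, ENNReal.ofReal_le_ofReal_iff hφ0] at hle
  -- If `L σ = 0`, all block coefficients vanish and so does the chaos. Otherwise `L`, `σ` and `φ`
  -- are positive and the chaining applies with `θ = σ / φ`.
  rcases eq_or_lt_of_le (mul_nonneg hL hσ0) with h0 | hpos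
  · refine le_trans (le_of_eq ?_) zero_le
    refine Finset.sum_eq_zero fun s _ => ?_
    simp only [ENNReal.iSup_eq_zero, ENNReal.ofReal_eq_zero]
    intro f hf
    have h1 := sum_block_sq_le hn x B (G f) f (hG0 f hf) (hfσ f hf)
    rw [show L * Real.sqrt (numPairs n) * σ = 0 by linear_combination -Real.sqrt (numPairs n) * h0]
      at h1
    simpa using abs_chaos_le B (G f) s le_rfl h1
  have hLpos : 0 < L := lt_of_le_of_ne hL (by rintro rfl; simp at hpos)
  have hσpos : 0 < σ := lt_of_le_of_ne hσ0 (by intro h; simp [← h] at hpos)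
  have hφpos : 0 < φ := hσpos.trans_le hσφ
  have hθφ : σ / φ * φ = σ := div_mul_cancel₀ _ hφpos.ne'
  have h1 := sum_iSup_chaos_le_lintegral hn x B hne G hLpos hG hG0 (div_pos hσpos hφpos) hφpos
    (by rw [hθφ]; exact hfσ)
  have h2 := lintegral_one_add_entropy_le (Q := Q) (𝓕 := 𝓕) (c := c) (θ := σ / φ)
    (normQ_empirical_triangle hn x) hφpos (hc.imp id fun h => ⟨h.1, h.2, fun r hr => by
      by_contra! hcon
      rw [hθφ] at hr
      have : S ≤ ENNReal.ofReal r := iSup₂_le fun f hf => ENNReal.ofReal_le_ofReal (hcon f hf)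
      rw [hSσ, ENNReal.ofReal_le_ofReal_iff'] at this
      rcases this with h | h <;> linarith⟩)
  -- This replaces the random upper limit `σ / (2 φ)` by the fixed `a`. The factor `1 + σ / (φ a)`,
  -- multiplied by `φ`, becomes `φ + σ / a`.
  have h3 := lintegral_Ioc_le_of_antitone (antitone_add_entropy c 𝓕 Q hφ0) ha
    (by positivity : 0 ≤ σ / φ / 2)
  refine h1.trans ?_
  gcongr _ * ?_
  calc _ ≤ ENNReal.ofReal (32 * L * w * φ) * (3 * ((1 + ENNReal.ofReal (σ / φ / a)) *
        J₂ c F 𝓕 a)) := by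
        gcongr
        refine h2.trans ?_
        gcongr
        refine h3.trans (mul_le_mul' ?_ (J₂_ge c F 𝓕 a Q))
        have : σ / φ / 2 ≤ σ / φ := half_le_self (by positivity)
        gcongr
    _ = ENNReal.ofReal (96 * L * w) * J₂ c F 𝓕 a *
          (ENNReal.ofReal φ * (1 + ENNReal.ofReal (σ / φ / a))) := by
        rw [show 32 * L * w * φ = 32 * (L * w) * φ by ring,
          show 96 * L * w = 3 * (32 * (L * w)) by ring, ENNReal.ofReal_mul (by positivity),
          ENNReal.ofReal_mul (p := 3) (by norm_num), show ENNReal.ofReal 3 = 3 by simp]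
        ring
    _ = _ := by
        congr 1
        rw [mul_add, mul_one, ← ENNReal.ofReal_mul hφ0, hSσ, ← ENNReal.ofReal_div_of_pos ha]
        congr 2
        field_simp

end Pointwise

/-! ### Symmetrization of completely degenerate blocks -/

section Symmetrization

variable {χ τ : Type*} {n : ℕ}

lemma _root_.Measurable.comp_uncurried {α β γ δ : Type*} [MeasurableSpace α] [MeasurableSpace β]
    [MeasurableSpace γ] [MeasurableSpace δ] {k : α → β → γ}
    (hk : Measurable (Function.uncurry k)) {u : δ → α} {v : δ → β} (hu : Measurable u)
    (hv : Measurable v) : Measurable fun x => k (u x) (v x) :=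
  hk.comp (hu.prodMk hv)

/-- The array of values of a kernel array at a sample. -/
def evalAt (f : Kernels n χ) (x : Fin n → χ) (i j : Fin n) : ℝ := f i j (x i) (x j)

/-- The second difference of a kernel array. -/
def secondDiff (f : Kernels n χ) : Kernels n (χ × χ) := fun i j y z =>
  f i j y.1 z.1 - f i j y.2 z.1 - f i j y.1 z.2 + f i j y.2 z.2

/-- Exchange the two components of the coordinates whose sign is negative. -/
def swapSigns (s : Fin n → ℤˣ) (y : Fin n → χ × χ) : Fin n → χ × χ :=
  fun i => if s i = 1 then y i else (y i).swap

lemma secondDiff_swapSigns (f : Kernels n χ) (s : Fin n → ℤˣ) (y : Fin n → χ × χ) (i j : Fin n) :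
    evalAt (secondDiff f) (swapSigns s y) i j
      = sgn (s i) * sgn (s j) * evalAt (secondDiff f) y i j := by
  have h1 : sgn 1 = 1 := by simp [sgn]
  have h2 : sgn (-1) = -1 := by simp [sgn]
  have h3 : (-1 : ℤˣ) ≠ 1 := by decide
  rcases Int.units_eq_one_or (s i) with hi | hi <;> rcases Int.units_eq_one_or (s j) with hj | hj <;>
    simp only [evalAt, swapSigns, hi, hj, h1, h2, if_true, if_neg h3, secondDiff, Prod.fst_swap,
      Prod.snd_swap] <;> ring

/-- Choose one of the two components in each coordinate. -/
def choice (p : Fin n → Prop) [DecidablePred p] (y : Fin n → χ × χ) : Fin n → χ :=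
  fun i => if p i then (y i).1 else (y i).2

/-- On a block, the second difference of a kernel is a sum of four copies of it. -/
lemma chaos_secondDiff (f : Kernels n χ) (B : Finset (Fin n)) (y : Fin n → χ × χ)
    (s : Fin n → ℤˣ) :
    chaos B (evalAt (secondDiff f) y) s =
      chaos B (evalAt f (choice (fun _ => True) y)) s - chaos B (evalAt f (choice (· ∉ B) y)) s
      - chaos B (evalAt f (choice (· ∈ B) y)) s + chaos B (evalAt f (choice (fun _ => False) y)) s := by
  simp only [chaos, ← Finset.sum_sub_distrib, ← Finset.sum_add_distrib]
  refine Finset.sum_congr rfl fun i hi => Finset.sum_congr rfl fun j hj => ?_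
  have hj' : j ∉ B := by simpa using hj
  simp only [evalAt, secondDiff, choice, hi, hj', not_true, not_false_iff, if_true, if_false]
  ring

variable [mχ : MeasurableSpace χ]

lemma measurable_evalAt {f : Kernels n χ}
    (hf : ∀ i j, i ≠ j → Measurable (Function.uncurry (f i j)))
    {i j : Fin n} (hij : i ≠ j) : Measurable fun x => evalAt f x i j :=
  (hf i j hij).comp_uncurried (measurable_pi_apply i) (measurable_pi_apply j)

lemma measurable_chaos_evalAt {f : Kernels n χ}
    (hf : ∀ i j, i ≠ j → Measurable (Function.uncurry (f i j))) (B : Finset (Fin n))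
    (s : Fin n → ℤˣ) : Measurable fun x => chaos B (evalAt f x) s :=
  Finset.measurable_sum _ fun _ hi => Finset.measurable_sum _ fun _ hj =>
    (measurable_evalAt hf (ne_of_mem_block hi hj)).const_mul _

lemma measurable_iSup_abs {α : Type*} [MeasurableSpace α] {𝓕 : Set τ} (h𝓕 : 𝓕.Countable)
    {u : τ → α → ℝ} (hu : ∀ f ∈ 𝓕, Measurable (u f)) :
    Measurable fun x => ⨆ f ∈ 𝓕, ENNReal.ofReal |u f x| :=
  Measurable.biSup 𝓕 h𝓕 fun f hf =>
    ENNReal.measurable_ofReal.comp (continuous_abs.measurable.comp (hu f hf))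

lemma integrable_of_abs_le {α : Type*} [MeasurableSpace α] {μ : Measure α} [IsFiniteMeasure μ]
    {u : α → ℝ} (hu : Measurable u) {M : ℝ} (hM : ∀ x, |u x| ≤ M) : Integrable u μ :=
  Integrable.of_bound hu.aestronglyMeasurable M (Filter.Eventually.of_forall hM)

lemma measurable_secondDiff {f : Kernels n χ}
    (hf : ∀ i j, i ≠ j → Measurable (Function.uncurry (f i j))) (i j : Fin n) (hij : i ≠ j) :
    Measurable (Function.uncurry (secondDiff f i j)) := by
  have h := hf i j hij
  have h1 : ∀ {u v : (χ × χ) × (χ × χ) → χ}, Measurable u → Measurable v →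
      Measurable fun w => f i j (u w) (v w) := fun hu hv => h.comp (hu.prodMk hv)
  exact (((h1 (by fun_prop) (by fun_prop)).sub (h1 (by fun_prop) (by fun_prop))).sub
    (h1 (by fun_prop) (by fun_prop))).add (h1 (by fun_prop) (by fun_prop))

/-- The completely degenerate part in the Hoeffding decomposition. -/
noncomputable def degenerate (π : Measure (Fin n → χ)) (f : Kernels n χ) (x : Fin n → χ)
    (i j : Fin n) : ℝ :=
  f i j (x i) (x j) - (∫ x', f i j (x' i) (x j) ∂π) - (∫ x', f i j (x i) (x' j) ∂π)
    + ∫ x', f i j (x' i) (x' j) ∂π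

variable (P : Fin n → Measure χ) [∀ i, IsProbabilityMeasure (P i)]

lemma measurePreserving_swapSigns (s : Fin n → ℤˣ) :
    MeasurePreserving (swapSigns s) (Measure.pi fun i => (P i).prod (P i))
      (Measure.pi fun i => (P i).prod (P i)) := by
  refine measurePreserving_pi (f := fun i (z : χ × χ) => if s i = 1 then z else z.swap) _ _ fun i => ?_
  by_cases h : s i = 1
  · simp only [h, if_true]
    exact MeasurePreserving.id _
  · simpa only [h, if_false] using Measure.measurePreserving_swap

lemma measurePreserving_choice (p : Fin n → Prop) [DecidablePred p] :
    MeasurePreserving (choice (χ := χ) p) (Measure.pi fun i => (P i).prod (P i))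
      (Measure.pi P) := by
  refine measurePreserving_pi (f := fun i (z : χ × χ) => if p i then z.1 else z.2) _ _ fun i => ?_
  by_cases h : p i
  · simpa only [h, if_true] using measurePreserving_fst
  · simpa only [h, if_false] using measurePreserving_snd

/-- On `B × Bᶜ` the two arguments of a kernel use disjoint sets of coordinates. Each of the four
terms of the second difference is therefore the chaos at one sample, obtained by a choice in each
coordinate and distributed as `Measure.pi P`. -/
lemma lintegral_secondDiff_le {𝓕 : Set τ} (h𝓕 : 𝓕.Countable) (g : τ → Kernels n χ)
    (hg : ∀ f ∈ 𝓕, ∀ i j, i ≠ j → Measurable (Function.uncurry (g f i j)))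
    (B : Finset (Fin n)) (s : Fin n → ℤˣ) :
    ∫⁻ y, ⨆ f ∈ 𝓕, ENNReal.ofReal |chaos B (evalAt (secondDiff (g f)) y) s|
        ∂(Measure.pi fun i => (P i).prod (P i))
      ≤ 4 * ∫⁻ x, ⨆ f ∈ 𝓕, ENNReal.ofReal |chaos B (evalAt (g f) x) s| ∂(Measure.pi P) := by
  set Ψ : (Fin n → χ) → ℝ≥0∞ := fun x => ⨆ f ∈ 𝓕, ENNReal.ofReal |chaos B (evalAt (g f) x) s|
    with hΨ
  have hΨm : Measurable Ψ := measurable_iSup_abs h𝓕 fun f hf =>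
    measurable_chaos_evalAt (hg f hf) B s
  have hle : ∀ x, ∀ f ∈ 𝓕, ENNReal.ofReal |chaos B (evalAt (g f) x) s| ≤ Ψ x := fun x f hf =>
    le_iSup₂ (f := fun f (_ : f ∈ 𝓕) => ENNReal.ofReal |chaos B (evalAt (g f) x) s|) f hf
  have hm : ∀ (p : Fin n → Prop) [DecidablePred p], Measurable fun y : Fin n → χ × χ =>
      Ψ (choice p y) := fun p _ => hΨm.comp (measurePreserving_choice P p).measurable
  have hint : ∀ (p : Fin n → Prop) [DecidablePred p], ∫⁻ y, Ψ (choice p y)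
      ∂(Measure.pi fun i => (P i).prod (P i)) = ∫⁻ x, Ψ x ∂(Measure.pi P) := fun p _ =>
    (measurePreserving_choice P p).lintegral_comp hΨm
  calc _ ≤ ∫⁻ y, (Ψ (choice (fun _ => True) y) + Ψ (choice (· ∉ B) y) + Ψ (choice (· ∈ B) y) +
        Ψ (choice (fun _ => False) y)) ∂(Measure.pi fun i => (P i).prod (P i)) := by
        refine lintegral_mono fun y => iSup₂_le fun f hf => ?_
        rw [chaos_secondDiff]
        have tri : ∀ p q r t : ℝ, ENNReal.ofReal |p - q - r + t| ≤ ENNReal.ofReal |p| +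
            ENNReal.ofReal |q| + ENNReal.ofReal |r| + ENNReal.ofReal |t| := by
          intro p q r t
          rw [← ENNReal.ofReal_add (abs_nonneg _) (abs_nonneg _),
            ← ENNReal.ofReal_add (by positivity) (abs_nonneg _),
            ← ENNReal.ofReal_add (by positivity) (abs_nonneg _)]
          refine ENNReal.ofReal_le_ofReal ?_
          have h1 := abs_add_le (p - q - r) t
          have h2 := abs_sub (p - q) r
          have h3 := abs_sub p q
          linarith
        exact (tri _ _ _ _).trans (add_le_add (add_le_add (add_le_add (hle _ f hf) (hle _ f hf))
          (hle _ f hf)) (hle _ f hf))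
    _ = _ := by
        rw [lintegral_add_right _ (hm _), lintegral_add_right _ (hm _),
          lintegral_add_right _ (hm _), hint, hint, hint, hint]
        ring

/-- Symmetrization of a completely degenerate block. -/
lemma lintegral_degenerate_le {𝓕 : Set τ} (h𝓕 : 𝓕.Countable) (g : τ → Kernels n χ)
    (hg : ∀ f ∈ 𝓕, ∀ i j, i ≠ j → Measurable (Function.uncurry (g f i j))) {M : ℝ}
    (hM : ∀ f ∈ 𝓕, ∀ i j, i ≠ j → ∀ x x', |g f i j x x'| ≤ M)
    (B : Finset (Fin n)) (s : Fin n → ℤˣ) :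
    ∫⁻ x, ⨆ f ∈ 𝓕, ENNReal.ofReal
        |∑ i ∈ B, ∑ j ∈ Bᶜ, degenerate (Measure.pi P) (g f) x i j| ∂(Measure.pi P)
      ≤ 4 * ∫⁻ x, ⨆ f ∈ 𝓕, ENNReal.ofReal |chaos B (evalAt (g f) x) s| ∂(Measure.pi P) := by
  set π := Measure.pi P with hπ
  set ρ := Measure.pi fun i => (P i).prod (P i) with hρ
  set Φ : (Fin n → ℤˣ) → (Fin n → χ × χ) → ℝ≥0∞ := fun s y =>
    ⨆ f ∈ 𝓕, ENNReal.ofReal |chaos B (evalAt (secondDiff (g f)) y) s| with hΦ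
  have hΦm : ∀ s, Measurable (Φ s) := fun s => measurable_iSup_abs h𝓕 fun f hf =>
    measurable_chaos_evalAt (measurable_secondDiff (hg f hf)) B s
  set e := (MeasurableEquiv.arrowProdEquivProdArrow χ χ (Fin n)) with he
  have hmp : MeasurePreserving e.symm (π.prod π) ρ :=
    (measurePreserving_arrowProdEquivProdArrow χ χ (Fin n) P P).symm
  have hzip : ∀ x x' i, e.symm (x, x') i = (x i, x' i) := fun x x' i => rfl
  -- The degenerate part is the mean of the second difference over an independent copy `x'` of the
  -- sample; the absolute value moves inside.
  have step1 : ∀ x, ∀ f ∈ 𝓕, ENNReal.ofReal |∑ i ∈ B, ∑ j ∈ Bᶜ, degenerate π (g f) x i j| ≤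
      ∫⁻ x', ENNReal.ofReal |chaos B (evalAt (secondDiff (g f)) (e.symm (x, x'))) 1| ∂π := by
    intro x f hf
    have hi1 : ∀ i j, i ≠ j → Integrable (fun x' : Fin n → χ => g f i j (x' i) (x j)) π :=
      fun i j hij => integrable_of_abs_le ((hg f hf i j hij).comp_uncurried
        (measurable_pi_apply i) measurable_const) fun _ => hM f hf i j hij _ _
    have hi2 : ∀ i j, i ≠ j → Integrable (fun x' : Fin n → χ => g f i j (x i) (x' j)) π :=
      fun i j hij => integrable_of_abs_le ((hg f hf i j hij).comp_uncurried
        measurable_const (measurable_pi_apply j)) fun _ => hM f hf i j hij _ _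
    have hi3 : ∀ i j, i ≠ j → Integrable (fun x' : Fin n → χ => g f i j (x' i) (x' j)) π :=
      fun i j hij => integrable_of_abs_le (measurable_evalAt (hg f hf) hij)
        fun _ => hM f hf i j hij _ _
    have hint : ∀ i ∈ B, ∀ j ∈ Bᶜ, Integrable (fun x' : Fin n → χ => g f i j (x i) (x j) -
        g f i j (x' i) (x j) - g f i j (x i) (x' j) + g f i j (x' i) (x' j)) π := by
      intro i hi j hj
      have hij := ne_of_mem_block hi hj
      exact (((integrable_const _).sub (hi1 i j hij)).sub (hi2 i j hij)).add (hi3 i j hij)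
    have heq : ∑ i ∈ B, ∑ j ∈ Bᶜ, degenerate π (g f) x i j =
        ∫ x', chaos B (evalAt (secondDiff (g f)) (e.symm (x, x'))) 1 ∂π := by
      have hc : ∀ x', chaos B (evalAt (secondDiff (g f)) (e.symm (x, x'))) 1 =
          ∑ i ∈ B, ∑ j ∈ Bᶜ, (g f i j (x i) (x j) -
            g f i j (x' i) (x j) - g f i j (x i) (x' j) + g f i j (x' i) (x' j)) := by
        intro x'
        simp [chaos, evalAt, secondDiff, hzip, sgn]
      simp only [hc]
      rw [integral_finsetSum _ fun i hi => integrable_finsetSum _ fun j hj => hint i hi j hj]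
      refine Finset.sum_congr rfl fun i hi => ?_
      rw [integral_finsetSum _ fun j hj => hint i hi j hj]
      refine Finset.sum_congr rfl fun j hj => ?_
      have hij := ne_of_mem_block hi hj
      have k1 : Integrable (fun x' : Fin n → χ => g f i j (x i) (x j) - g f i j (x' i) (x j)) π :=
        (integrable_const _).sub (hi1 i j hij)
      have k2 : Integrable (fun x' : Fin n → χ => g f i j (x i) (x j) - g f i j (x' i) (x j) -
          g f i j (x i) (x' j)) π := k1.sub (hi2 i j hij)
      rw [integral_add k2 (hi3 i j hij), integral_sub k1 (hi2 i j hij),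
        integral_sub (integrable_const _) (hi1 i j hij), integral_const]
      simp [degenerate]
    rw [heq, ← Real.norm_eq_abs, ofReal_norm]
    refine (enorm_integral_le_lintegral_enorm _).trans (le_of_eq ?_)
    refine lintegral_congr fun x' => ?_
    rw [← Real.norm_eq_abs, ofReal_norm]
  calc _ ≤ ∫⁻ x, ∫⁻ x', Φ 1 (e.symm (x, x')) ∂π ∂π := by
        refine lintegral_mono fun x => iSup₂_le fun f hf => (step1 x f hf).trans ?_
        refine lintegral_mono fun x' => ?_
        exact le_iSup₂ (f := fun f (_ : f ∈ 𝓕) => ENNReal.ofReal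
          |chaos B (evalAt (secondDiff (g f)) (e.symm (x, x'))) 1|) f hf
    _ = ∫⁻ y, Φ 1 y ∂ρ := by
        rw [← hmp.lintegral_comp (hΦm 1)]
        exact (lintegral_prod (fun z => Φ 1 (e.symm z))
          ((hΦm 1).comp hmp.measurable).aemeasurable).symm
    _ = ∫⁻ y, Φ s y ∂ρ := by
        -- Exchanging `x i` and `x' i` where `s i = -1` preserves the law and multiplies the `(i,
        -- j)` entry by `s i * s j`. The signs may thus be inserted for each fixed `s`.
        rw [← (measurePreserving_swapSigns P s).lintegral_comp (hΦm 1)]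
        refine lintegral_congr fun y => iSup_congr fun f => iSup_congr fun _ => ?_
        have : chaos B (evalAt (secondDiff (g f)) (swapSigns s y)) 1 =
            chaos B (evalAt (secondDiff (g f)) y) s := by
          simp [chaos, secondDiff_swapSigns, sgn]
        rw [this]
    _ ≤ _ := lintegral_secondDiff_le P h𝓕 g hg B s

end Symmetrization

/-! ### Conditional expectations, Rademacher laws and random splitting -/

section Laws

variable {Ω χ : Type*} [mΩ : MeasurableSpace Ω] [mχ : MeasurableSpace χ] {n : ℕ}
  {μ : Measure Ω} [IsProbabilityMeasure μ]

/-- Conditional expectation of a function of two independent variables given the first one. -/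
lemma condExp_comp_of_indepFun {U V : Ω → χ} (hU : Measurable U) (hV : Measurable V)
    (hUV : IndepFun U V μ) {g : χ → χ → ℝ} (hg : Measurable (Function.uncurry g)) {M : ℝ}
    (hM : ∀ x y, |g x y| ≤ M) :
    (fun ω => ∫ ω', g (U ω) (V ω') ∂μ)
      =ᵐ[μ] μ[fun ω => g (U ω) (V ω) | MeasurableSpace.comap U mχ] := by
  have hPU : IsProbabilityMeasure (μ.map U) := Measure.isProbabilityMeasure_map hU.aemeasurable
  have hPV : IsProbabilityMeasure (μ.map V) := Measure.isProbabilityMeasure_map hV.aemeasurable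
  have hψ : StronglyMeasurable fun u => ∫ v, g u v ∂(μ.map V) :=
    hg.stronglyMeasurable.integral_prod_right
  have hψV : ∀ u, ∫ v, g u v ∂(μ.map V) = ∫ ω', g u (V ω') ∂μ := fun u =>
    integral_map hV.aemeasurable (hg.comp measurable_prodMk_left).aestronglyMeasurable
  have hψM : ∀ u, |∫ v, g u v ∂(μ.map V)| ≤ M := fun u => by
    have := norm_integral_le_of_norm_le_const (μ := μ.map V)
      (f := fun v => g u v) (Filter.Eventually.of_forall fun v => hM u v)
    simpa using this
  simp only [← hψV]
  have hlaw : μ.map (fun ω => (U ω, V ω)) = (μ.map U).prod (μ.map V) :=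
    (indepFun_iff_map_prod_eq_prod_map_map hU.aemeasurable hV.aemeasurable).1 hUV
  have hgi : ∀ (ν : Measure (χ × χ)) [IsFiniteMeasure ν], Integrable (Function.uncurry g) ν :=
    fun ν _ => Integrable.of_bound hg.aestronglyMeasurable M
      (Filter.Eventually.of_forall fun z => hM z.1 z.2)
  refine ae_eq_condExp_of_forall_setIntegral_eq hU.comap_le ?_ ?_ ?_ ?_
  · exact Integrable.of_bound (hg.comp (hU.prodMk hV)).aestronglyMeasurable M
      (Filter.Eventually.of_forall fun ω => hM _ _)
  · intro s _ _
    exact (Integrable.of_bound (hψ.measurable.comp hU).aestronglyMeasurable M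
      (Filter.Eventually.of_forall fun ω => hψM _)).integrableOn
  · rintro _ ⟨t, ht, rfl⟩ _
    have h1 : ∫ ω in U ⁻¹' t, (∫ v, g (U ω) v ∂(μ.map V)) ∂μ
        = ∫ u in t, (∫ v, g u v ∂(μ.map V)) ∂(μ.map U) :=
      (setIntegral_map ht hψ.aestronglyMeasurable hU.aemeasurable).symm
    have h2 : ∫ ω in U ⁻¹' t, g (U ω) (V ω) ∂μ
        = ∫ z in t ×ˢ Set.univ, Function.uncurry g z ∂((μ.map U).prod (μ.map V)) := by
      rw [← hlaw, setIntegral_map (ht.prod MeasurableSet.univ) hg.aestronglyMeasurable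
        (hU.prodMk hV).aemeasurable]
      congr 2
      ext ω; simp
    rw [h1, h2, setIntegral_prod _ (hgi _).integrableOn]
    simp [Function.uncurry]
  · exact (hψ.measurable.comp (comap_measurable U)).aestronglyMeasurable

/-- The law of a vector of independent Rademacher variables. -/
lemma lintegral_comp_rademacher {ε : Fin n → Ω → ℝ} (hε : ∀ i, IsRademacher μ (ε i))
    (hind : iIndepFun ε μ) (Φ : (Fin n → ℝ) → ℝ≥0∞) :
    ∫⁻ ω, Φ (fun i => ε i ω) ∂μ =
      (Fintype.card (Fin n → ℤˣ) : ℝ≥0∞)⁻¹ * ∑ s : Fin n → ℤˣ, Φ fun i => sgn (s i) := by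
  -- These events have equal mass and cover `Ω` up to a null set. The integrand is constant on each,
  -- so `Φ` may be arbitrary.
  set E : (Fin n → ℤˣ) → Set Ω := fun s => ⋂ i ∈ Finset.univ, ε i ⁻¹' {sgn (s i)} with hE
  have hmem : ∀ s ω, ω ∈ E s ↔ ∀ i, ε i ω = sgn (s i) := fun s ω => by simp [hE]
  have hmeas : ∀ s, MeasurableSet (E s) := fun s =>
    Finset.measurableSet_biInter _ fun i _ => (hε i).1 (measurableSet_singleton _)
  have hμE : ∀ s, μ (E s) = (Fintype.card (Fin n → ℤˣ) : ℝ≥0∞)⁻¹ := by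
    intro s
    rw [hE, hind.measure_inter_preimage_eq_mul Finset.univ fun i _ => measurableSet_singleton _]
    have : ∀ i, μ (ε i ⁻¹' {sgn (s i)}) = 1 / 2 := by
      intro i
      rcases sgn_eq_or (s i) with h | h <;> rw [h]
      · exact (hε i).2.1
      · exact (hε i).2.2
    simp only [this]
    simp [ENNReal.inv_pow]
  have hdisj : Pairwise (Function.onFun Disjoint E) := by
    intro s t hst
    refine Set.disjoint_left.2 fun ω h1 h2 => hst ?_
    ext i
    have := ((hmem s ω).1 h1 i).symm.trans ((hmem t ω).1 h2 i)
    simpa [sgn] using this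
  have hfull : μ (⋃ s, E s) = 1 := by
    rw [measure_iUnion hdisj hmeas, tsum_fintype]
    simp only [hμE, Finset.sum_const, Finset.card_univ, nsmul_eq_mul]
    exact ENNReal.mul_inv_cancel (by exact_mod_cast Fintype.card_ne_zero) (by simp)
  have hae : ∀ᵐ ω ∂μ, ω ∈ ⋃ s, E s :=
    (prob_compl_eq_zero_iff (MeasurableSet.iUnion hmeas)).2 hfull
  rw [← setLIntegral_univ, ← setLIntegral_congr (s := ⋃ s, E s) (by
    rw [Filter.eventuallyEq_univ]; exact hae), lintegral_iUnion hmeas hdisj, tsum_fintype,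
    Finset.mul_sum]
  refine Finset.sum_congr rfl fun s _ => ?_
  rw [setLIntegral_congr_fun (hmeas s) (g := fun _ => Φ fun i => sgn (s i)) fun ω hω => by
    simp only [(hmem s ω).1 hω], setLIntegral_const, hμE, mul_comm]

lemma lintegral_comp_sample_rademacher {X : Fin n → Ω → χ} {ε : Fin n → Ω → ℝ}
    (hX : ∀ i, Measurable (X i)) (hε : ∀ i, IsRademacher μ (ε i)) (hind : iIndepFun ε μ)
    (hXε : IndepFun (fun ω i => X i ω) (fun ω i => ε i ω) μ)
    {Φ : (Fin n → χ) → (Fin n → ℝ) → ℝ≥0∞} (hΦ : Measurable (Function.uncurry Φ)) :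
    ∫⁻ ω, Φ (fun i => X i ω) (fun i => ε i ω) ∂μ =
      (Fintype.card (Fin n → ℤˣ) : ℝ≥0∞)⁻¹ *
        ∫⁻ x, ∑ s : Fin n → ℤˣ, Φ x (fun i => sgn (s i)) ∂(μ.map fun ω i => X i ω) := by
  have hXm : Measurable fun ω i => X i ω := measurable_pi_iff.2 hX
  have hεm : Measurable fun ω i => ε i ω := measurable_pi_iff.2 fun i => (hε i).1
  have hPX : IsProbabilityMeasure (μ.map fun ω i => X i ω) :=
    Measure.isProbabilityMeasure_map hXm.aemeasurable
  have hPε : IsProbabilityMeasure (μ.map fun ω i => ε i ω) :=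
    Measure.isProbabilityMeasure_map hεm.aemeasurable
  have hlaw := (indepFun_iff_map_prod_eq_prod_map_map hXm.aemeasurable hεm.aemeasurable).1 hXε
  have h1 : ∫⁻ ω, Φ (fun i => X i ω) (fun i => ε i ω) ∂μ =
      ∫⁻ z, Function.uncurry Φ z ∂(μ.map fun ω => ((fun i => X i ω), fun i => ε i ω)) :=
    (lintegral_map hΦ (hXm.prodMk hεm)).symm
  rw [h1, hlaw, lintegral_prod _ hΦ.aemeasurable, ← lintegral_const_mul' _ _
    (by simp)]
  refine lintegral_congr fun x => ?_
  rw [← lintegral_comp_rademacher hε hind (Φ x)]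
  exact lintegral_map (hΦ.comp measurable_prodMk_left) hεm

/-- Random splitting of a sum over pairs into blocks. -/
lemma card_mul_sum_pairs (u : Fin n → Fin n → ℝ) :
    Fintype.card (Fin n → ℤˣ) * ∑ p ∈ pairs n, u p.1 p.2 =
      4 * ∑ r : Fin n → ℤˣ, ∑ i ∈ Finset.univ.filter (r · = 1),
        ∑ j ∈ (Finset.univ.filter (r · = 1))ᶜ, u i j := by
  -- The indicator of `r i = 1`, `r j = -1` is `(1 + r i) (1 - r j) / 4`, and for `i ≠ j` the
  -- product averages to `1`.
  have hblock : ∀ r : Fin n → ℤˣ, 4 * ∑ i ∈ Finset.univ.filter (r · = 1),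
      ∑ j ∈ (Finset.univ.filter (r · = 1))ᶜ, u i j =
      ∑ p ∈ pairs n, (1 + sgn (r p.1)) * (1 - sgn (r p.2)) * u p.1 p.2 := by
    intro r
    have h3 : (-1 : ℤˣ) ≠ 1 := by decide
    rw [pairs, Finset.sum_filter (fun p : Fin n × Fin n => p.1 ≠ p.2), Fintype.sum_prod_type, Finset.sum_filter, Finset.mul_sum]
    refine Finset.sum_congr rfl fun i _ => ?_
    rw [Finset.compl_filter, Finset.sum_filter]
    rcases Int.units_eq_one_or (r i) with hi | hi
    · rw [if_pos hi, Finset.mul_sum]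
      refine Finset.sum_congr rfl fun j _ => ?_
      rcases Int.units_eq_one_or (r j) with hj | hj
      · simp [hj, sgn]
      · have hij : i ≠ j := by rintro rfl; rw [hi] at hj; exact h3 hj.symm
        simp only [hi, hj, hij, h3, sgn, not_false_iff, if_true, ne_eq]
        push_cast; ring
    · rw [if_neg (by rw [hi]; exact h3), mul_zero]
      symm
      refine Finset.sum_eq_zero fun j _ => ?_
      simp [hi, sgn]
  rw [Finset.mul_sum Finset.univ]
  simp only [hblock]
  rw [Finset.sum_comm, Finset.mul_sum]
  refine Finset.sum_congr rfl fun p hp => ?_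
  have hp' : p.1 ≠ p.2 := by simpa [pairs] using hp
  have h1 : ∀ i : Fin n, ∑ r : Fin n → ℤˣ, sgn (r i) = 0 := fun i => by
    have := sum_flip i fun r : Fin n → ℤˣ => sgn (r i)
    simp only [flip_same, sgn_neg, Finset.sum_neg_distrib] at this
    linarith
  have h2 : ∑ r : Fin n → ℤˣ, sgn (r p.1) * sgn (r p.2) = 0 := by
    have := sum_flip p.1 fun r : Fin n → ℤˣ => sgn (r p.1) * sgn (r p.2)
    simp only [flip_same, flip_ne hp'.symm, sgn_neg, neg_mul, Finset.sum_neg_distrib] at this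
    linarith
  rw [← Finset.sum_mul]
  congr 1
  calc (Fintype.card (Fin n → ℤˣ) : ℝ) = ∑ r : Fin n → ℤˣ, (1 + sgn (r p.1) - sgn (r p.2)
        - sgn (r p.1) * sgn (r p.2)) := by
        rw [Finset.sum_sub_distrib, Finset.sum_sub_distrib, Finset.sum_add_distrib, h1, h1, h2]
        simp
    _ = _ := Finset.sum_congr rfl fun r _ => by ring

lemma card_mul_iSup_sum_pairs_le {τ : Type*} {𝓕 : Set τ} (u : τ → Fin n → Fin n → ℝ) :
    Fintype.card (Fin n → ℤˣ) * ⨆ f ∈ 𝓕, ENNReal.ofReal |∑ p ∈ pairs n, u f p.1 p.2| ≤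
      4 * ∑ r : Fin n → ℤˣ, ⨆ f ∈ 𝓕, ENNReal.ofReal
        |∑ i ∈ Finset.univ.filter (r · = 1),
          ∑ j ∈ (Finset.univ.filter (r · = 1))ᶜ, u f i j| := by
  simp only [ENNReal.mul_iSup]
  refine iSup₂_le fun f hf => ?_
  rw [← ENNReal.ofReal_natCast, ← ENNReal.ofReal_mul (by positivity),
    ← abs_of_nonneg (Nat.cast_nonneg (α := ℝ) (Fintype.card (Fin n → ℤˣ))), ← abs_mul,
    card_mul_sum_pairs, abs_mul, ENNReal.ofReal_mul (abs_nonneg _)]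
  have h4 : ENNReal.ofReal |(4 : ℝ)| = 4 := by
    rw [abs_of_pos (by norm_num)]; simp
  rw [h4]
  gcongr
  refine (ENNReal.ofReal_le_ofReal (Finset.abs_sum_le_sum_abs _ _)).trans ?_
  rw [ENNReal.ofReal_sum_of_nonneg fun _ _ => abs_nonneg _]
  refine Finset.sum_le_sum fun r _ => ?_
  exact le_iSup₂ (f := fun f (_ : f ∈ 𝓕) => ENNReal.ofReal
        |∑ i ∈ Finset.univ.filter (r · = 1),
          ∑ j ∈ (Finset.univ.filter (r · = 1))ᶜ, u f i j|) f hf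

end Laws

/-! ### Integration over the sample and the Hoeffding decomposition -/

section Expectations

variable {χ : Type*} [mχ : MeasurableSpace χ] {n : ℕ}

lemma sq_lintegral_le {α : Type*} [MeasurableSpace α] {μ : Measure α} [IsProbabilityMeasure μ]
    {u : α → ℝ≥0∞} (hu : Measurable u) : (∫⁻ x, u x ∂μ) ^ 2 ≤ ∫⁻ x, u x ^ 2 ∂μ := by
  have h := ENNReal.lintegral_mul_le_Lp_mul_Lq μ (p := 2) (q := 2)
    (Real.HolderConjugate.two_two) hu.aemeasurable (g := fun _ => 1) aemeasurable_const
  simp only [Pi.mul_apply, mul_one, one_pow, ENNReal.one_rpow, lintegral_const, measure_univ,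
    ENNReal.rpow_ofNat] at h
  calc _ ≤ ((∫⁻ x, u x ^ 2 ∂μ) ^ (1 / 2 : ℝ)) ^ 2 := pow_le_pow_left' h 2
    _ = _ := by rw [← ENNReal.rpow_natCast, ← ENNReal.rpow_mul]; norm_num

lemma measurable_normQ_empirical (hn : 2 ≤ n) {f : Kernels n χ}
    (hf : ∀ i j, i ≠ j → Measurable (Function.uncurry (f i j))) :
    Measurable fun x => normQ (empirical hn x) f := by
  have h : ∀ x, normQ (empirical hn x) f =
      Real.sqrt ((∑ p ∈ pairs n, evalAt f x p.1 p.2 ^ 2) / numPairs n) := fun x => by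
    rw [← Real.sqrt_sq (normQ_nonneg _ _), normQ_empirical_sq]; rfl
  simp only [h]
  refine Measurable.sqrt (Measurable.div_const (Finset.measurable_sum _ fun p hp => ?_) _)
  exact (measurable_evalAt hf (by simpa [pairs] using hp)).pow_const 2

/-- The integral of the supremum of the chaos over a block. -/
lemma lintegral_sum_iSup_chaos_le (hn : 2 ≤ n) (π : Measure (Fin n → χ)) (B : Finset (Fin n))
    {𝓕 : Set (Kernels n χ)} (h𝓕 : 𝓕.Countable) (hne : 𝓕.Nonempty)
    (hm : ∀ f ∈ 𝓕, ∀ i j, i ≠ j → Measurable (Function.uncurry (f i j))) {F : Kernels n χ}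
    (hFm : ∀ i j, i ≠ j → Measurable (Function.uncurry (F i j)))
    (hF : ∀ f ∈ 𝓕, ∀ i j, i ≠ j → ∀ x x', |f i j x x'| ≤ F i j x x')
    (G : Kernels n χ → Kernels n χ) {L : ℝ} (hL : 0 ≤ L)
    (hG : ∀ f ∈ 𝓕, ∀ g ∈ 𝓕, ∀ i j, i ≠ j → ∀ x x',
      |G f i j x x' - G g i j x x'| ≤ L * |f i j x x' - g i j x x'|)
    (hG0 : ∀ f ∈ 𝓕, ∀ i j, i ≠ j → ∀ x x', |G f i j x x'| ≤ L * |f i j x x'|)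
    {c : ℝ≥0∞} (hc : c = 1 ∨ c = 0 ∧ 0 ∈ 𝓕) {a : ℝ} (ha : 0 < a) :
    ∫⁻ x, ∑ s : Fin n → ℤˣ, ⨆ f ∈ 𝓕, ENNReal.ofReal |chaos B (evalAt (G f) x) s| ∂π ≤
      Fintype.card (Fin n → ℤˣ) * (ENNReal.ofReal (96 * L * Real.sqrt (numPairs n)) *
        J₂ c F 𝓕 a * (∫⁻ x, ENNReal.ofReal (normQ (empirical hn x) F) ∂π +
          (∫⁻ x, ⨆ f ∈ 𝓕, ENNReal.ofReal (normQ (empirical hn x) f) ∂π) / ENNReal.ofReal a)) := by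
  have m1 : Measurable fun x => ENNReal.ofReal (normQ (empirical hn x) F) :=
    (measurable_normQ_empirical hn hFm).ennreal_ofReal
  have m2 : Measurable fun x => ⨆ f ∈ 𝓕, ENNReal.ofReal (normQ (empirical hn x) f) :=
    Measurable.biSup 𝓕 h𝓕 fun f hf => (measurable_normQ_empirical hn (hm f hf)).ennreal_ofReal
  refine (lintegral_mono fun x => sum_iSup_chaos_le hn x B hne
    (fun f hf i j hij => hF f hf i j hij _ _) (fun f => evalAt (G f) x) hL
    (fun f hf g hg i j hij => hG f hf g hg i j hij _ _)
    (fun f hf i j hij => hG0 f hf i j hij _ _) hc ha).trans (le_of_eq ?_)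
  rw [lintegral_const_mul _ (by fun_prop), lintegral_const_mul _ (by fun_prop),
    lintegral_add_left m1]
  congr 3
  simp only [div_eq_mul_inv]
  rw [lintegral_mul_const _ m2]

/-- Splitting into blocks, for expectations. -/
lemma lintegral_iSup_sum_pairs_le {α τ : Type*} [MeasurableSpace α] {𝓕 : Set τ}
    (h𝓕 : 𝓕.Countable) (π : Measure α) (u : τ → α → Fin n → Fin n → ℝ)
    (hu : ∀ f ∈ 𝓕, ∀ i j, i ≠ j → Measurable fun x => u f x i j) {M : ℝ≥0∞}
    (hM : ∀ B : Finset (Fin n),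
      ∫⁻ x, ⨆ f ∈ 𝓕, ENNReal.ofReal |∑ i ∈ B, ∑ j ∈ Bᶜ, u f x i j| ∂π ≤ M) :
    ∫⁻ x, ⨆ f ∈ 𝓕, ENNReal.ofReal |∑ p ∈ pairs n, u f x p.1 p.2| ∂π ≤ 4 * M := by
  have hc0 : (Fintype.card (Fin n → ℤˣ) : ℝ≥0∞) ≠ 0 := by exact_mod_cast Fintype.card_ne_zero
  have hct : (Fintype.card (Fin n → ℤˣ) : ℝ≥0∞) ≠ ⊤ := ENNReal.natCast_ne_top _
  have hmeas : ∀ B : Finset (Fin n), Measurable fun x =>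
      ⨆ f ∈ 𝓕, ENNReal.ofReal |∑ i ∈ B, ∑ j ∈ Bᶜ, u f x i j| := fun B =>
    measurable_iSup_abs h𝓕 fun f hf => Finset.measurable_sum _ fun i hi =>
      Finset.measurable_sum _ fun j hj => hu f hf i j (ne_of_mem_block hi hj)
  rw [← ENNReal.mul_le_mul_iff_right hc0 hct, ← lintegral_const_mul' _ _ hct]
  calc _ ≤ ∫⁻ x, 4 * ∑ r : Fin n → ℤˣ, ⨆ f ∈ 𝓕, ENNReal.ofReal
        |∑ i ∈ Finset.univ.filter (r · = 1),
          ∑ j ∈ (Finset.univ.filter (r · = 1))ᶜ, u f x i j| ∂π :=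
        lintegral_mono fun x => card_mul_iSup_sum_pairs_le fun f => u f x
    _ = 4 * ∑ r : Fin n → ℤˣ, ∫⁻ x, ⨆ f ∈ 𝓕, ENNReal.ofReal
        |∑ i ∈ Finset.univ.filter (r · = 1),
          ∑ j ∈ (Finset.univ.filter (r · = 1))ᶜ, u f x i j| ∂π := by
        rw [lintegral_const_mul' _ _ (by simp), lintegral_finsetSum _ fun r _ => hmeas _]
    _ ≤ 4 * ∑ r : Fin n → ℤˣ, M := by gcongr; exact hM _
    _ = _ := by
        simp only [Finset.sum_const, Finset.card_univ, nsmul_eq_mul]; ring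

/-- The squares of a kernel array. -/
def sqKernels (f : Kernels n χ) : Kernels n χ := fun i j x y => f i j x y ^ 2

lemma measurable_sqKernels {f : Kernels n χ}
    (hf : ∀ i j, i ≠ j → Measurable (Function.uncurry (f i j))) (i j : Fin n) (hij : i ≠ j) :
    Measurable (Function.uncurry (sqKernels f i j)) := (hf i j hij).pow_const 2

lemma measurable_integral_fst {k : χ → χ → ℝ} (hk : Measurable (Function.uncurry k))
    (π : Measure (Fin n → χ)) [SFinite π] (i j : Fin n) :
    Measurable fun x : Fin n → χ => ∫ x', k (x i) (x' j) ∂π :=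
  (StronglyMeasurable.integral_prod_right
    (f := fun (x : Fin n → χ) (x' : Fin n → χ) => k (x i) (x' j))
    (hk.comp_uncurried ((measurable_pi_apply i).comp measurable_fst)
      ((measurable_pi_apply j).comp measurable_snd)).stronglyMeasurable).measurable

lemma measurable_integral_snd {k : χ → χ → ℝ} (hk : Measurable (Function.uncurry k))
    (π : Measure (Fin n → χ)) [SFinite π] (i j : Fin n) :
    Measurable fun x : Fin n → χ => ∫ x', k (x' i) (x j) ∂π :=
  (StronglyMeasurable.integral_prod_right
    (f := fun (x : Fin n → χ) (x' : Fin n → χ) => k (x' i) (x j))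
    (hk.comp_uncurried ((measurable_pi_apply i).comp measurable_snd)
      ((measurable_pi_apply j).comp measurable_fst)).stronglyMeasurable).measurable

lemma measurable_degenerate {f : Kernels n χ}
    (hf : ∀ i j, i ≠ j → Measurable (Function.uncurry (f i j))) (π : Measure (Fin n → χ))
    [SFinite π] {i j : Fin n} (hij : i ≠ j) : Measurable fun x => degenerate π f x i j :=
  (((measurable_evalAt hf hij).sub (measurable_integral_snd (hf i j hij) π i j)).sub
    (measurable_integral_fst (hf i j hij) π i j)).add measurable_const

/-- The expected supremum of the empirical second moments, by the Hoeffding decomposition. -/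
lemma lintegral_iSup_normQ_sq_le (hn : 2 ≤ n) (π : Measure (Fin n → χ)) [IsProbabilityMeasure π]
    {𝓕 : Set (Kernels n χ)} (h𝓕 : 𝓕.Countable)
    (hm : ∀ f ∈ 𝓕, ∀ i j, i ≠ j → Measurable (Function.uncurry (f i j))) :
    ∫⁻ x, ⨆ f ∈ 𝓕, ENNReal.ofReal (normQ (empirical hn x) f ^ 2) ∂π ≤
      ENNReal.ofReal (1 / numPairs n) * ∫⁻ x, ⨆ f ∈ 𝓕, ENNReal.ofReal
          |∑ p ∈ pairs n, degenerate π (sqKernels f) x p.1 p.2| ∂π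
      + ∫⁻ x, ⨆ f ∈ 𝓕, ENNReal.ofReal ((1 / numPairs n) * |∑ p ∈ pairs n,
          ((∫ x', sqKernels f p.1 p.2 (x p.1) (x' p.2) ∂π) -
            ∫ x', sqKernels f p.1 p.2 (x' p.1) (x' p.2) ∂π)|) ∂π
      + ∫⁻ x, ⨆ f ∈ 𝓕, ENNReal.ofReal ((1 / numPairs n) * |∑ p ∈ pairs n,
          ((∫ x', sqKernels f p.1 p.2 (x' p.1) (x p.2) ∂π) -
            ∫ x', sqKernels f p.1 p.2 (x' p.1) (x' p.2) ∂π)|) ∂π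
      + ⨆ f ∈ 𝓕, ENNReal.ofReal ((1 / numPairs n) * ∑ p ∈ pairs n,
          ∫ x', sqKernels f p.1 p.2 (x' p.1) (x' p.2) ∂π) := by
  have hN := numPairs_pos hn
  have hN1 : 0 ≤ 1 / numPairs n := by positivity
  set m : Kernels n χ → Fin n → Fin n → ℝ := fun f i j =>
    ∫ x', sqKernels f i j (x' i) (x' j) ∂π with hm_def
  set u₁ : Kernels n χ → (Fin n → χ) → ℝ := fun f x => ∑ p ∈ pairs n,
    degenerate π (sqKernels f) x p.1 p.2 with hu₁
  set u₂ : Kernels n χ → (Fin n → χ) → ℝ := fun f x => ∑ p ∈ pairs n,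
    ((∫ x', sqKernels f p.1 p.2 (x p.1) (x' p.2) ∂π) - m f p.1 p.2) with hu₂
  set u₃ : Kernels n χ → (Fin n → χ) → ℝ := fun f x => ∑ p ∈ pairs n,
    ((∫ x', sqKernels f p.1 p.2 (x' p.1) (x p.2) ∂π) - m f p.1 p.2) with hu₃
  have hpair : ∀ p ∈ pairs n, p.1 ≠ p.2 := fun p hp => by simpa [pairs] using hp
  have m1 : Measurable fun x => ⨆ f ∈ 𝓕, ENNReal.ofReal |u₁ f x| :=
    measurable_iSup_abs h𝓕 fun f hf => Finset.measurable_sum _ fun p hp =>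
      measurable_degenerate (measurable_sqKernels (hm f hf)) π (hpair p hp)
  have m2 : Measurable fun x => ⨆ f ∈ 𝓕, ENNReal.ofReal ((1 / numPairs n) * |u₂ f x|) := by
    refine Measurable.biSup 𝓕 h𝓕 fun f hf => (Measurable.const_mul
      (continuous_abs.measurable.comp ?_) _).ennreal_ofReal
    exact Finset.measurable_sum _ fun p hp => (measurable_integral_fst
      (measurable_sqKernels (hm f hf) _ _ (hpair p hp)) π _ _).sub measurable_const
  have m3 : Measurable fun x => ⨆ f ∈ 𝓕, ENNReal.ofReal ((1 / numPairs n) * |u₃ f x|) := by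
    refine Measurable.biSup 𝓕 h𝓕 fun f hf => (Measurable.const_mul
      (continuous_abs.measurable.comp ?_) _).ennreal_ofReal
    exact Finset.measurable_sum _ fun p hp => (measurable_integral_snd
      (measurable_sqKernels (hm f hf) _ _ (hpair p hp)) π _ _).sub measurable_const
  have hpt : ∀ f x, normQ (empirical hn x) f ^ 2 ≤ (1 / numPairs n) * |u₁ f x| +
      (1 / numPairs n) * |u₂ f x| + (1 / numPairs n) * |u₃ f x| +
      (1 / numPairs n) * ∑ p ∈ pairs n, m f p.1 p.2 := by
    intro f x
    -- The Hoeffding decomposition of `f²`: degenerate part, two centred projections, mean.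
    have : ∑ p ∈ pairs n, f p.1 p.2 (x p.1) (x p.2) ^ 2 =
        u₁ f x + u₂ f x + u₃ f x + ∑ p ∈ pairs n, m f p.1 p.2 := by
      simp only [hu₁, hu₂, hu₃, ← Finset.sum_add_distrib]
      refine Finset.sum_congr rfl fun p _ => ?_
      simp only [degenerate, sqKernels, hm_def]
      ring
    rw [normQ_empirical_sq, this, div_eq_mul_one_div, mul_comm, ← mul_add, ← mul_add, ← mul_add]
    refine mul_le_mul_of_nonneg_left ?_ hN1
    gcongr ?_ + ?_ + ?_ + _
    exacts [le_abs_self _, le_abs_self _, le_abs_self _]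
  calc _ ≤ ∫⁻ x, (ENNReal.ofReal (1 / numPairs n) * (⨆ f ∈ 𝓕, ENNReal.ofReal |u₁ f x|)
        + (⨆ f ∈ 𝓕, ENNReal.ofReal ((1 / numPairs n) * |u₂ f x|))
        + (⨆ f ∈ 𝓕, ENNReal.ofReal ((1 / numPairs n) * |u₃ f x|))
        + ⨆ f ∈ 𝓕, ENNReal.ofReal ((1 / numPairs n) * ∑ p ∈ pairs n, m f p.1 p.2)) ∂π := by
        refine lintegral_mono fun x => iSup₂_le fun f hf => ?_
        refine (ENNReal.ofReal_le_ofReal (hpt f x)).trans ?_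
        refine ENNReal.ofReal_add_le.trans (add_le_add (ENNReal.ofReal_add_le.trans
          (add_le_add (ENNReal.ofReal_add_le.trans (add_le_add ?_ ?_)) ?_)) ?_)
        · rw [ENNReal.ofReal_mul hN1]
          gcongr
          exact le_iSup₂ (f := fun f (_ : f ∈ 𝓕) => ENNReal.ofReal |u₁ f x|) f hf
        · exact le_iSup₂ (f := fun f (_ : f ∈ 𝓕) =>
            ENNReal.ofReal ((1 / numPairs n) * |u₂ f x|)) f hf
        · exact le_iSup₂ (f := fun f (_ : f ∈ 𝓕) =>
            ENNReal.ofReal ((1 / numPairs n) * |u₃ f x|)) f hf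
        · exact le_iSup₂ (f := fun f (_ : f ∈ 𝓕) =>
            ENNReal.ofReal ((1 / numPairs n) * ∑ p ∈ pairs n, m f p.1 p.2)) f hf
    _ = _ := by
        rw [lintegral_add_right _ measurable_const, lintegral_add_right _ m3,
          lintegral_add_right _ m2, lintegral_const_mul _ m1,
          lintegral_const, measure_univ, mul_one]

end Expectations

/-! ### The quadratic inequality and the final bound -/

section Main

variable {Ω χ : Type*} [mΩ : MeasurableSpace Ω] [mχ : MeasurableSpace χ] {n : ℕ}
  {μ : Measure Ω}

lemma mem_pairs {p : Fin n × Fin n} : p ∈ pairs n ↔ p.1 ≠ p.2 := by simp [pairs]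

/-- Squaring is `2R`-Lipschitz on `[-R, R]`; this lets the nets of `𝓕` serve for the class of
squares. -/
lemma sq_abs_sub_sq_le {R x y : ℝ} (hx : |x| ≤ R) (hy : |y| ≤ R) :
    |x ^ 2 - y ^ 2| ≤ 2 * R * |x - y| := by
  rw [sq_sub_sq, abs_mul]
  gcongr
  exact (abs_add_le _ _).trans (by linarith)

lemma integral_sample {X : Fin n → Ω → χ} (hX : ∀ i, Measurable (X i)) {f : Kernels n χ}
    (hf : ∀ i j, i ≠ j → Measurable (Function.uncurry (f i j))) {i j : Fin n} (hij : i ≠ j) :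
    ∫ x', sqKernels f i j (x' i) (x' j) ∂(μ.map fun ω i => X i ω) =
      ∫ ω, sqKernel X f i j ω ∂μ :=
  integral_map (measurable_pi_iff.2 hX).aemeasurable
    (measurable_evalAt (measurable_sqKernels hf) hij).aestronglyMeasurable

lemma normP_sq (hn : 2 ≤ n) {X : Fin n → Ω → χ} (hX : ∀ i, Measurable (X i)) {F : Kernels n χ}
    (hF : ∀ i j, i ≠ j → Measurable (Function.uncurry (F i j))) :
    normP μ X F ^ 2 = ∫⁻ x, ENNReal.ofReal (normQ (empirical hn x) F) ^ 2
      ∂(μ.map fun ω i => X i ω) := by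
  have hN := numPairs_pos hn
  have hXm : Measurable fun ω i => X i ω := measurable_pi_iff.2 hX
  rw [lintegral_map ((measurable_normQ_empirical hn hF).ennreal_ofReal.pow_const 2) hXm, normP,
    ← ENNReal.rpow_natCast, ← ENNReal.rpow_mul]
  norm_num
  rw [← lintegral_finsetSum, div_eq_mul_inv, ← lintegral_mul_const' _ _ (by simpa using hN)]
  · refine lintegral_congr fun ω => ?_
    rw [← ENNReal.ofReal_pow (normQ_nonneg _ _), normQ_empirical_sq, ENNReal.ofReal_div_of_pos hN,
      ENNReal.ofReal_sum_of_nonneg fun _ _ => sq_nonneg _, div_eq_mul_inv]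
  · intro p hp
    exact (((hF _ _ (mem_pairs.1 hp)).comp_uncurried (hX _) (hX _)).pow_const 2).ennreal_ofReal

variable [IsProbabilityMeasure μ]

lemma ae_condExp_fst {X : Fin n → Ω → χ} (hX : ∀ i, Measurable (X i)) (hind : iIndepFun X μ)
    {f : Kernels n χ} (hf : ∀ i j, i ≠ j → Measurable (Function.uncurry (f i j))) {R : ℝ}
    (hR : ∀ i j, i ≠ j → ∀ x x', |f i j x x'| ≤ R) {i j : Fin n} (hij : i ≠ j) :
    ∀ᵐ ω ∂μ, ∫ x', sqKernels f i j (X i ω) (x' j) ∂(μ.map fun ω i => X i ω) =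
      (μ[sqKernel X f i j | MeasurableSpace.comap (X i) mχ]) ω := by
  have h := condExp_comp_of_indepFun (hX i) (hX j) (hind.indepFun hij)
    (measurable_sqKernels hf i j hij) (M := R ^ 2) fun x y => by
      rw [sqKernels, abs_pow]; exact pow_le_pow_left₀ (abs_nonneg _) (hR i j hij x y) 2
  filter_upwards [h] with ω hω
  refine Eq.trans ?_ hω
  exact integral_map (measurable_pi_iff.2 hX).aemeasurable
    ((measurable_sqKernels hf i j hij).comp_uncurried measurable_const
      (measurable_pi_apply j)).aestronglyMeasurable

lemma ae_condExp_snd {X : Fin n → Ω → χ} (hX : ∀ i, Measurable (X i)) (hind : iIndepFun X μ)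
    {f : Kernels n χ} (hf : ∀ i j, i ≠ j → Measurable (Function.uncurry (f i j))) {R : ℝ}
    (hR : ∀ i j, i ≠ j → ∀ x x', |f i j x x'| ≤ R) {i j : Fin n} (hij : i ≠ j) :
    ∀ᵐ ω ∂μ, ∫ x', sqKernels f i j (x' i) (X j ω) ∂(μ.map fun ω i => X i ω) =
      (μ[sqKernel X f i j | MeasurableSpace.comap (X j) mχ]) ω := by
  have h := condExp_comp_of_indepFun (hX j) (hX i) (hind.indepFun hij.symm)
    (g := fun y x => sqKernels f i j x y)
    ((measurable_sqKernels hf i j hij).comp_uncurried measurable_snd measurable_fst)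
    (M := R ^ 2) fun x y => by
      rw [sqKernels, abs_pow]; exact pow_le_pow_left₀ (abs_nonneg _) (hR i j hij y x) 2
  filter_upwards [h] with ω hω
  refine Eq.trans ?_ hω
  exact integral_map (measurable_pi_iff.2 hX).aemeasurable
    ((measurable_sqKernels hf i j hij).comp_uncurried (measurable_pi_apply i)
      measurable_const).aestronglyMeasurable

/-- By independence, integrating out the second argument is a version of the conditional expectation
given `X i`. Countability of `𝓕` allows one null set for all `f`. -/
lemma lintegral_iSup_le_Gamma₁Sq {X : Fin n → Ω → χ} (hX : ∀ i, Measurable (X i))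
    (hind : iIndepFun X μ) {𝓕 : Set (Kernels n χ)} (h𝓕 : 𝓕.Countable)
    (hm : ∀ f ∈ 𝓕, ∀ i j, i ≠ j → Measurable (Function.uncurry (f i j))) {R : ℝ}
    (hR : ∀ f ∈ 𝓕, ∀ i j, i ≠ j → ∀ x x', |f i j x x'| ≤ R) :
    ∫⁻ x, ⨆ f ∈ 𝓕, ENNReal.ofReal ((1 / numPairs n) * |∑ p ∈ pairs n,
      ((∫ x', sqKernels f p.1 p.2 (x p.1) (x' p.2) ∂(μ.map fun ω i => X i ω)) -
        ∫ x', sqKernels f p.1 p.2 (x' p.1) (x' p.2) ∂(μ.map fun ω i => X i ω))|)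
      ∂(μ.map fun ω i => X i ω) ≤ Gamma₁Sq μ X 𝓕 := by
  refine (lintegral_map_le _ _).trans (le_of_eq (lintegral_congr_ae ?_))
  have : ∀ᵐ ω ∂μ, ∀ f ∈ 𝓕, ∀ p : Fin n × Fin n, p.1 ≠ p.2 →
      ∫ x', sqKernels f p.1 p.2 (X p.1 ω) (x' p.2) ∂(μ.map fun ω i => X i ω) =
      (μ[sqKernel X f p.1 p.2 | MeasurableSpace.comap (X p.1) mχ]) ω :=
    (ae_ball_iff h𝓕).2 fun f hf => ae_all_iff.2 fun p => ae_all_iff.2 fun hp =>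
      ae_condExp_fst hX hind (hm f hf) (hR f hf) hp
  filter_upwards [this] with ω hω
  refine iSup_congr fun f => iSup_congr fun hf => ?_
  congr 3
  refine Finset.sum_congr rfl fun p hp => ?_
  rw [hω f hf p (mem_pairs.1 hp), integral_sample hX (hm f hf) (mem_pairs.1 hp)]

lemma lintegral_iSup_le_Gamma₂Sq {X : Fin n → Ω → χ} (hX : ∀ i, Measurable (X i))
    (hind : iIndepFun X μ) {𝓕 : Set (Kernels n χ)} (h𝓕 : 𝓕.Countable)
    (hm : ∀ f ∈ 𝓕, ∀ i j, i ≠ j → Measurable (Function.uncurry (f i j))) {R : ℝ}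
    (hR : ∀ f ∈ 𝓕, ∀ i j, i ≠ j → ∀ x x', |f i j x x'| ≤ R) :
    ∫⁻ x, ⨆ f ∈ 𝓕, ENNReal.ofReal ((1 / numPairs n) * |∑ p ∈ pairs n,
      ((∫ x', sqKernels f p.1 p.2 (x' p.1) (x p.2) ∂(μ.map fun ω i => X i ω)) -
        ∫ x', sqKernels f p.1 p.2 (x' p.1) (x' p.2) ∂(μ.map fun ω i => X i ω))|)
      ∂(μ.map fun ω i => X i ω) ≤ Gamma₂Sq μ X 𝓕 := by
  refine (lintegral_map_le _ _).trans (le_of_eq (lintegral_congr_ae ?_))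
  have : ∀ᵐ ω ∂μ, ∀ f ∈ 𝓕, ∀ p : Fin n × Fin n, p.1 ≠ p.2 →
      ∫ x', sqKernels f p.1 p.2 (x' p.1) (X p.2 ω) ∂(μ.map fun ω i => X i ω) =
      (μ[sqKernel X f p.1 p.2 | MeasurableSpace.comap (X p.2) mχ]) ω :=
    (ae_ball_iff h𝓕).2 fun f hf => ae_all_iff.2 fun p => ae_all_iff.2 fun hp =>
      ae_condExp_snd hX hind (hm f hf) (hR f hf) hp
  filter_upwards [this] with ω hω
  refine iSup_congr fun f => iSup_congr fun hf => ?_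
  congr 3
  refine Finset.sum_congr rfl fun p hp => ?_
  rw [hω f hf p (mem_pairs.1 hp), integral_sample hX (hm f hf) (mem_pairs.1 hp)]

/-- The Rademacher chaos over a block. -/
lemma lintegral_rademacher_block_le (hn : 2 ≤ n) {X : Fin n → Ω → χ} {ε : Fin n → Ω → ℝ}
    (hX : ∀ i, Measurable (X i)) (hε : ∀ i, IsRademacher μ (ε i)) (hεind : iIndepFun ε μ)
    (hXε : IndepFun (fun ω i => X i ω) (fun ω i => ε i ω) μ) (B : Finset (Fin n))
    {𝓕 : Set (Kernels n χ)} (h𝓕 : 𝓕.Countable) (hne : 𝓕.Nonempty)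
    (hm : ∀ f ∈ 𝓕, ∀ i j, i ≠ j → Measurable (Function.uncurry (f i j))) {F : Kernels n χ}
    (hFm : ∀ i j, i ≠ j → Measurable (Function.uncurry (F i j)))
    (hF : ∀ f ∈ 𝓕, ∀ i j, i ≠ j → ∀ x x', |f i j x x'| ≤ F i j x x')
    {c : ℝ≥0∞} (hc : c = 1 ∨ c = 0 ∧ 0 ∈ 𝓕) {a : ℝ} (ha : 0 < a) :
    ∫⁻ ω, ⨆ f ∈ 𝓕, ENNReal.ofReal |∑ i ∈ B, ∑ j ∈ Bᶜ,
        ε i ω * ε j ω * f i j (X i ω) (X j ω)| ∂μ ≤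
      ENNReal.ofReal (96 * Real.sqrt (numPairs n)) * J₂ c F 𝓕 a *
        (∫⁻ x, ENNReal.ofReal (normQ (empirical hn x) F) ∂(μ.map fun ω i => X i ω) +
          (∫⁻ x, ⨆ f ∈ 𝓕, ENNReal.ofReal (normQ (empirical hn x) f)
            ∂(μ.map fun ω i => X i ω)) / ENNReal.ofReal a) := by
  have hc0 : (Fintype.card (Fin n → ℤˣ) : ℝ≥0∞) ≠ 0 := by exact_mod_cast Fintype.card_ne_zero
  have hct : (Fintype.card (Fin n → ℤˣ) : ℝ≥0∞) ≠ ⊤ := ENNReal.natCast_ne_top _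
  have hmeas : Measurable (Function.uncurry fun (x : Fin n → χ) (e : Fin n → ℝ) =>
      ⨆ f ∈ 𝓕, ENNReal.ofReal |∑ i ∈ B, ∑ j ∈ Bᶜ, e i * e j * f i j (x i) (x j)|) := by
    refine measurable_iSup_abs h𝓕 (u := fun f (z : (Fin n → χ) × (Fin n → ℝ)) =>
      ∑ i ∈ B, ∑ j ∈ Bᶜ, z.2 i * z.2 j * f i j (z.1 i) (z.1 j)) fun f hf =>
      Finset.measurable_sum _ fun i hi => Finset.measurable_sum _ fun j hj => ?_
    refine Measurable.mul (by fun_prop) ((hm f hf i j (ne_of_mem_block hi hj)).comp_uncurried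
      (by fun_prop) (by fun_prop))
  rw [lintegral_comp_sample_rademacher hX hε hεind hXε hmeas]
  have h := lintegral_sum_iSup_chaos_le hn (μ.map fun ω i => X i ω) B h𝓕 hne hm hFm hF id
    zero_le_one (fun f _ g _ i j _ x x' => by simp) (fun f _ i j _ x x' => by simp) hc ha
  rw [mul_one] at h
  rw [ENNReal.inv_mul_le_iff hc0 hct]
  exact h

/-- The completely degenerate part of the squares over a block. -/
lemma lintegral_degenerate_sq_block_le (hn : 2 ≤ n) (P : Fin n → Measure χ)
    [∀ i, IsProbabilityMeasure (P i)] (B : Finset (Fin n))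
    {𝓕 : Set (Kernels n χ)} (h𝓕 : 𝓕.Countable) (hne : 𝓕.Nonempty)
    (hm : ∀ f ∈ 𝓕, ∀ i j, i ≠ j → Measurable (Function.uncurry (f i j)))
    {R : ℝ} (hR0 : 0 ≤ R) (hR : ∀ f ∈ 𝓕, ∀ i j, i ≠ j → ∀ x x', |f i j x x'| ≤ R)
    {F : Kernels n χ} (hFm : ∀ i j, i ≠ j → Measurable (Function.uncurry (F i j)))
    (hF : ∀ f ∈ 𝓕, ∀ i j, i ≠ j → ∀ x x', |f i j x x'| ≤ F i j x x')
    {c : ℝ≥0∞} (hc : c = 1 ∨ c = 0 ∧ 0 ∈ 𝓕) {a : ℝ} (ha : 0 < a) :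
    ∫⁻ x, ⨆ f ∈ 𝓕, ENNReal.ofReal |∑ i ∈ B, ∑ j ∈ Bᶜ,
        degenerate (Measure.pi P) (sqKernels f) x i j| ∂(Measure.pi P) ≤
      4 * (ENNReal.ofReal (96 * (2 * R) * Real.sqrt (numPairs n)) * J₂ c F 𝓕 a *
        (∫⁻ x, ENNReal.ofReal (normQ (empirical hn x) F) ∂(Measure.pi P) +
          (∫⁻ x, ⨆ f ∈ 𝓕, ENNReal.ofReal (normQ (empirical hn x) f) ∂(Measure.pi P)) /
            ENNReal.ofReal a)) := by
  have hc0 : (Fintype.card (Fin n → ℤˣ) : ℝ≥0∞) ≠ 0 := by exact_mod_cast Fintype.card_ne_zero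
  have hct : (Fintype.card (Fin n → ℤˣ) : ℝ≥0∞) ≠ ⊤ := ENNReal.natCast_ne_top _
  have h := lintegral_sum_iSup_chaos_le hn (Measure.pi P) B h𝓕 hne hm hFm hF sqKernels
    (L := 2 * R) (by positivity)
    (fun f hf g hg i j hij x x' => sq_abs_sub_sq_le (hR f hf i j hij x x') (hR g hg i j hij x x'))
    (fun f hf i j hij x x' => by
      have := sq_abs_sub_sq_le (hR f hf i j hij x x') (y := 0) (by simpa using hR0)
      simpa [sqKernels] using this) hc ha
  rw [lintegral_finsetSum _ fun s _ => measurable_iSup_abs h𝓕 fun f hf =>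
    measurable_chaos_evalAt (measurable_sqKernels (hm f hf)) B s] at h
  rw [← ENNReal.mul_le_mul_iff_right hc0 hct]
  calc _ = ∑ s : Fin n → ℤˣ, ∫⁻ x, ⨆ f ∈ 𝓕, ENNReal.ofReal |∑ i ∈ B, ∑ j ∈ Bᶜ,
        degenerate (Measure.pi P) (sqKernels f) x i j| ∂(Measure.pi P) := by simp
    _ ≤ ∑ s : Fin n → ℤˣ, 4 * ∫⁻ x, ⨆ f ∈ 𝓕, ENNReal.ofReal
        |chaos B (evalAt (sqKernels f) x) s| ∂(Measure.pi P) :=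
        Finset.sum_le_sum fun s _ => lintegral_degenerate_le P h𝓕 sqKernels
          (fun f hf => measurable_sqKernels (hm f hf)) (M := R ^ 2)
          (fun f hf i j hij x x' => by
            rw [sqKernels, abs_pow]
            exact pow_le_pow_left₀ (abs_nonneg _) (hR f hf i j hij x x') 2) B s
    _ ≤ _ := by
        rw [← Finset.mul_sum, mul_left_comm]
        exact mul_le_mul' le_rfl h

/-- Solving the quadratic inequality for the expected radius. -/
lemma mul_add_div_le_of_sq_le {φ J a b E : ℝ≥0} (ha : 0 < a)
    (h : E ^ 2 ≤ a ^ 2 * φ ^ 2 + 6144 * b ^ 2 * φ * J * (φ + E / a)) :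
    384 * J * (φ + E / a) ≤ 5000000 * φ * J * (1 + J * b ^ 2 / a ^ 2) := by
  have ha' : (0 : ℝ) < a := ha
  have h' : (E : ℝ) ^ 2 ≤ a ^ 2 * φ ^ 2 + 6144 * b ^ 2 * φ * J * (φ + E / a) := by exact_mod_cast h
  -- If `E > a φ`, then `a² φ² ≤ a φ E` and `φ ≤ E / a`, so the right side of `h` is at most `E`
  -- times a constant; divide by `E`. Finally `384 * 12288 < 5000000`.
  have hE : (E : ℝ) / a ≤ φ + 12288 * (φ * (J * b ^ 2 / a ^ 2)) := by
    rw [div_le_iff₀ ha']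
    have e : (φ + 12288 * (φ * (J * b ^ 2 / a ^ 2)) : ℝ) * a =
        a * φ + 12288 * b ^ 2 * φ * J / a := by field_simp
    rw [e]
    by_cases hle : (E : ℝ) ≤ a * φ
    · exact hle.trans (le_add_of_nonneg_right (by positivity))
    · push Not at hle
      have hφE : (φ : ℝ) ≤ E / a := by rw [le_div_iff₀ ha']; linarith
      have hE0 : (0 : ℝ) < E := lt_of_le_of_lt (by positivity) hle
      refine le_of_mul_le_mul_right ?_ hE0
      calc (E : ℝ) * E = E ^ 2 := by ring
        _ ≤ a ^ 2 * φ ^ 2 + 6144 * b ^ 2 * φ * J * (φ + E / a) := h'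
        _ ≤ a * φ * E + 6144 * b ^ 2 * φ * J * (E / a + E / a) := by
            have : (a : ℝ) ^ 2 * φ ^ 2 ≤ a * φ * E := by
              calc (a : ℝ) ^ 2 * φ ^ 2 = a * φ * (a * φ) := by ring
                _ ≤ _ := by gcongr
            gcongr
        _ = _ := by field_simp; ring
  have : (384 : ℝ) * J * (φ + E / a) ≤ 5000000 * φ * J * (1 + J * b ^ 2 / a ^ 2) := by
    set q : ℝ := J * b ^ 2 / a ^ 2 with hq
    have hq0 : 0 ≤ q := by positivity
    have h1 : (0 : ℝ) ≤ φ * J := by positivity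
    have h2 : (0 : ℝ) ≤ φ * J * q := by positivity
    calc (384 : ℝ) * J * (φ + E / a) ≤ 384 * J * (φ + (φ + 12288 * (φ * q))) := by gcongr
      _ ≤ _ := by nlinarith
  exact_mod_cast this

end Main

lemma inv_sqrt_numPairs_le {n : ℕ} (hn : 2 ≤ n) : 1 / Real.sqrt (numPairs n) ≤ 2 / n := by
  have h2 : (2 : ℝ) ≤ n := by exact_mod_cast hn
  have h0 : (0 : ℝ) < n := by linarith
  rw [div_le_div_iff₀ (Real.sqrt_pos.2 (numPairs_pos hn)) h0]
  have : (n : ℝ) / 2 ≤ Real.sqrt (numPairs n) := by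
    apply Real.le_sqrt_of_sq_le
    unfold numPairs
    nlinarith
  linarith

theorem expectedSup_le {Ω χ : Type*} [MeasurableSpace Ω] [MeasurableSpace χ]
    (μ : Measure Ω) [IsProbabilityMeasure μ] {n : ℕ} (hn : 2 ≤ n)
    (X : Fin n → Ω → χ) (ε : Fin n → Ω → ℝ)
    (hX : ∀ i, Measurable (X i)) (hind : iIndepFun X μ)
    (hε : ∀ i, IsRademacher μ (ε i)) (hεind : iIndepFun ε μ)
    (hXε : IndepFun (fun ω i => X i ω) (fun ω i => ε i ω) μ)
    {𝓕 : Set (Kernels n χ)} (h𝓕 : 𝓕.Countable) (hne : 𝓕.Nonempty)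
    (hm : ∀ f ∈ 𝓕, ∀ i j, i ≠ j → Measurable (Function.uncurry (f i j)))
    {R : ℝ} (hR : ∀ f ∈ 𝓕, ∀ i j, i ≠ j → ∀ x x', |f i j x x'| ≤ R)
    {F : Kernels n χ} (hFm : ∀ i j, i ≠ j → Measurable (Function.uncurry (F i j)))
    (hF : ∀ f ∈ 𝓕, ∀ i j, i ≠ j → ∀ x x', |f i j x x'| ≤ F i j x x')
    (hP0 : normP μ X F ≠ 0) (hPtop : normP μ X F ≠ ∞)
    {a b : ℝ≥0} (ha : 0 < a) (hA : A μ X F 𝓕 ≤ a) (hB : B μ X F R ≤ b)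
    {c : ℝ≥0∞} (hc : c = 1 ∨ c = 0 ∧ 0 ∈ 𝓕) :
    expectedSup μ X ε 𝓕 ≤ (5000000 : ℝ≥0) * normP μ X F * J₂ c F 𝓕 a *
      (1 + J₂ c F 𝓕 a * (b : ℝ≥0∞) ^ 2 / (a : ℝ≥0∞) ^ 2) := by
  have hN := numPairs_pos hn
  have hw0 : 0 < Real.sqrt (numPairs n) := Real.sqrt_pos.2 hN
  have hn0 : (n : ℝ≥0∞) ≠ 0 := by exact_mod_cast (by omega : n ≠ 0)
  set φ := normP μ X F with hφ
  set J := J₂ c F 𝓕 a with hJ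
  by_cases hJtop : J = ⊤
  · rw [hJtop, ENNReal.mul_top (by simpa using hP0), ENNReal.top_mul (by simp)]
    exact le_top
  have hR0 : 0 ≤ R := by
    obtain ⟨f, hf⟩ := hne
    obtain ⟨ω⟩ : Nonempty Ω := nonempty_of_isProbabilityMeasure μ
    exact (abs_nonneg _).trans (hR f hf ⟨0, by omega⟩ ⟨1, by omega⟩ (by simp)
      (X ⟨0, by omega⟩ ω) (X ⟨0, by omega⟩ ω))
  set P : Fin n → Measure χ := fun i => μ.map (X i) with hP
  have hPprob : ∀ i, IsProbabilityMeasure (P i) := fun i =>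
    Measure.isProbabilityMeasure_map (hX i).aemeasurable
  have hlaw : μ.map (fun ω i => X i ω) = Measure.pi P :=
    (iIndepFun_iff_map_fun_eq_pi_map fun i => (hX i).aemeasurable).1 hind
  have ha' : ENNReal.ofReal (a : ℝ) = a := ENNReal.ofReal_coe_nnreal
  set E₁ := ∫⁻ x, ENNReal.ofReal (normQ (empirical hn x) F) ∂(Measure.pi P) with hE₁
  set E₂ := ∫⁻ x, ⨆ f ∈ 𝓕, ENNReal.ofReal (normQ (empirical hn x) f) ∂(Measure.pi P) with hE₂
  have hE₁φ : E₁ ≤ φ := by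
    rw [← ENNReal.pow_le_pow_left_iff two_ne_zero, hφ, normP_sq hn hX hFm, hlaw]
    exact sq_lintegral_le (measurable_normQ_empirical hn hFm).ennreal_ofReal
  have hE₂E₁ : E₂ ≤ E₁ := lintegral_mono fun x => iSup₂_le fun f hf =>
    ENNReal.ofReal_le_ofReal
      (normQ_empirical_mono hn x fun i j hij => hF f hf i j hij _ _)
  -- Finiteness of the expected radius, supplied by the envelope, is what permits solving the
  -- quadratic inequality.
  have hE₂top : E₂ ≠ ⊤ := ne_top_of_le_ne_top hPtop (hE₂E₁.trans hE₁φ)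
  have hE₂sq : E₂ ^ 2 ≤ ∫⁻ x, ⨆ f ∈ 𝓕, ENNReal.ofReal (normQ (empirical hn x) f ^ 2)
      ∂(Measure.pi P) := by
    have hmeas : Measurable fun x => ⨆ f ∈ 𝓕, ENNReal.ofReal (normQ (empirical hn x) f) :=
      Measurable.biSup 𝓕 h𝓕 fun f hf => (measurable_normQ_empirical hn (hm f hf)).ennreal_ofReal
    refine (sq_lintegral_le hmeas).trans (lintegral_mono fun x => ?_)
    rw [ENNReal.iSup₂_pow_of_ne_zero _ two_ne_zero]
    refine iSup₂_mono fun f hf => ?_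
    rw [ENNReal.ofReal_pow (normQ_nonneg _ _)]
  have hAsq : Gamma₁Sq μ X 𝓕 + Gamma₂Sq μ X 𝓕 + SigmaSq μ X 𝓕 ≤ (a : ℝ≥0∞) ^ 2 * φ ^ 2 := by
    have h := pow_le_pow_left' hA 2
    rw [A, ← ENNReal.rpow_natCast, ← ENNReal.rpow_mul] at h
    norm_num at h
    rwa [ENNReal.div_le_iff (pow_ne_zero 2 hP0) (ENNReal.pow_ne_top hPtop)] at h
  have hBsq : ENNReal.ofReal R / n ≤ (b : ℝ≥0∞) ^ 2 * φ := by
    have h := pow_le_pow_left' hB 2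
    rw [B, ← ENNReal.rpow_natCast, ← ENNReal.rpow_mul] at h
    norm_num at h
    rw [ENNReal.div_le_iff (mul_ne_zero hn0 hP0)
      (ENNReal.mul_ne_top (ENNReal.natCast_ne_top n) hPtop)] at h
    rw [ENNReal.div_le_iff hn0 (ENNReal.natCast_ne_top n)]
    exact h.trans (le_of_eq (by ring))
  have hdeg : ∫⁻ x, ⨆ f ∈ 𝓕, ENNReal.ofReal
      |∑ p ∈ pairs n, degenerate (Measure.pi P) (sqKernels f) x p.1 p.2| ∂(Measure.pi P) ≤
      4 * (4 * (ENNReal.ofReal (96 * (2 * R) * Real.sqrt (numPairs n)) * J * (φ + E₂ / a))) := by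
    refine lintegral_iSup_sum_pairs_le h𝓕 _ (fun f => degenerate (Measure.pi P) (sqKernels f))
      (fun f hf i j hij => measurable_degenerate (measurable_sqKernels (hm f hf)) _ hij)
      fun B => ?_
    have h := lintegral_degenerate_sq_block_le hn P B h𝓕 hne hm hR0 hR hFm hF hc
      (NNReal.coe_pos.2 ha)
    rw [ha'] at h
    exact h.trans (by gcongr)
  have hquad : E₂ ^ 2 ≤ (a : ℝ≥0∞) ^ 2 * φ ^ 2 + 6144 * (b : ℝ≥0∞) ^ 2 * φ * J * (φ + E₂ / a) := by
    have h := lintegral_iSup_normQ_sq_le hn (Measure.pi P) h𝓕 hm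
    have h1 := lintegral_iSup_le_Gamma₁Sq hX hind h𝓕 hm hR
    have h2 := lintegral_iSup_le_Gamma₂Sq hX hind h𝓕 hm hR
    have h3 : ⨆ f ∈ 𝓕, ENNReal.ofReal ((1 / numPairs n) * ∑ p ∈ pairs n,
        ∫ x', sqKernels f p.1 p.2 (x' p.1) (x' p.2) ∂(Measure.pi P)) = SigmaSq μ X 𝓕 := by
      refine iSup_congr fun f => iSup_congr fun hf => ?_
      congr 2
      refine Finset.sum_congr rfl fun p hp => ?_
      rw [← hlaw, integral_sample hX (hm f hf) (mem_pairs.1 hp)]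
    rw [hlaw] at h1 h2
    -- One `4` comes from splitting into blocks, the other from the second difference, and `2 * R`
    -- from squaring: `16 * 96 * 2 = 3072`. Replacing `1 / √(n (n - 1))` by `2 / n` gives `6144`.
    have hcoef : ENNReal.ofReal (1 / numPairs n) * (4 * (4 * ENNReal.ofReal
        (96 * (2 * R) * Real.sqrt (numPairs n)))) ≤ 6144 * ((b : ℝ≥0∞) ^ 2 * φ) := by
      calc _ = ENNReal.ofReal (3072 * (R * (1 / Real.sqrt (numPairs n)))) := by
            rw [show (4 : ℝ≥0∞) = ENNReal.ofReal 4 by simp, ← ENNReal.ofReal_mul (by norm_num),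
              ← ENNReal.ofReal_mul (by norm_num), ← ENNReal.ofReal_mul (by positivity)]
            congr 1
            field_simp
            rw [Real.sq_sqrt hN.le]
            ring
        _ ≤ ENNReal.ofReal (6144 * (R / n)) := by
            refine ENNReal.ofReal_le_ofReal ?_
            have := mul_le_mul_of_nonneg_left (inv_sqrt_numPairs_le hn) hR0
            calc 3072 * (R * (1 / Real.sqrt (numPairs n))) ≤ 3072 * (R * (2 / n)) := by gcongr
              _ = _ := by ring
        _ = 6144 * (ENNReal.ofReal R / n) := by
            rw [ENNReal.ofReal_mul (by norm_num), ENNReal.ofReal_div_of_pos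
              (by exact_mod_cast (by omega : 0 < n)), ENNReal.ofReal_natCast]
            simp
        _ ≤ _ := by gcongr
    calc E₂ ^ 2 ≤ _ := hE₂sq.trans h
      _ ≤ ENNReal.ofReal (1 / numPairs n) * (4 * (4 * (ENNReal.ofReal
            (96 * (2 * R) * Real.sqrt (numPairs n)) * J * (φ + E₂ / a)))) +
          Gamma₁Sq μ X 𝓕 + Gamma₂Sq μ X 𝓕 + SigmaSq μ X 𝓕 :=
          add_le_add (add_le_add (add_le_add (mul_le_mul' le_rfl hdeg) h1) h2) h3.le
      _ = ENNReal.ofReal (1 / numPairs n) * (4 * (4 * ENNReal.ofReal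
            (96 * (2 * R) * Real.sqrt (numPairs n)))) * (J * (φ + E₂ / a)) +
          (Gamma₁Sq μ X 𝓕 + Gamma₂Sq μ X 𝓕 + SigmaSq μ X 𝓕) := by ring
      _ ≤ 6144 * ((b : ℝ≥0∞) ^ 2 * φ) * (J * (φ + E₂ / a)) + (a : ℝ≥0∞) ^ 2 * φ ^ 2 := by gcongr
      _ = _ := by ring
  have hsup : expectedSup μ X ε 𝓕 ≤ 384 * J * (φ + E₂ / a) := by
    have h := lintegral_iSup_sum_pairs_le h𝓕 μ
      (fun f ω i j => ε i ω * ε j ω * f i j (X i ω) (X j ω))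
      (fun f hf i j hij => ((hε i).1.mul (hε j).1).mul
        ((hm f hf i j hij).comp_uncurried (hX i) (hX j)))
      fun B => (lintegral_rademacher_block_le hn hX hε hεind hXε B h𝓕 hne hm hFm hF hc
        (NNReal.coe_pos.2 ha))
    rw [hlaw, ha'] at h
    have hpull : expectedSup μ X ε 𝓕 = ENNReal.ofReal (1 / Real.sqrt (numPairs n)) *
        ∫⁻ ω, ⨆ f ∈ 𝓕, ENNReal.ofReal
          |∑ p ∈ pairs n, ε p.1 ω * ε p.2 ω * f p.1 p.2 (X p.1 ω) (X p.2 ω)| ∂μ := by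
      rw [← lintegral_const_mul' _ _ ENNReal.ofReal_ne_top]
      refine lintegral_congr fun ω => ?_
      simp only [ENNReal.mul_iSup]
      refine iSup_congr fun f => iSup_congr fun _ => ?_
      rw [← ENNReal.ofReal_mul (by positivity), abs_div, abs_of_pos hw0, div_eq_mul_one_div,
        mul_comm]
    rw [hpull]
    calc _ ≤ ENNReal.ofReal (1 / Real.sqrt (numPairs n)) *
          (4 * (ENNReal.ofReal (96 * Real.sqrt (numPairs n)) * J * (φ + E₂ / a))) := by
          refine mul_le_mul' le_rfl (h.trans ?_)
          gcongr
      _ = (ENNReal.ofReal (1 / Real.sqrt (numPairs n)) *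
          (4 * ENNReal.ofReal (96 * Real.sqrt (numPairs n)))) * J * (φ + E₂ / a) := by ring
      _ = _ := by
          congr 2
          rw [show (4 : ℝ≥0∞) = ENNReal.ofReal 4 by simp, ← ENNReal.ofReal_mul (by norm_num),
            ← ENNReal.ofReal_mul (by positivity)]
          rw [show 1 / Real.sqrt (numPairs n) * (4 * (96 * Real.sqrt (numPairs n))) = 384 by
            field_simp; norm_num]
          simp
  refine hsup.trans ?_
  clear_value φ J E₂
  lift φ to ℝ≥0 using hPtop
  lift J to ℝ≥0 using hJtop
  lift E₂ to ℝ≥0 using hE₂top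
  have hane : a ≠ 0 := ha.ne'
  rw [← ENNReal.coe_div hane] at hquad ⊢
  have hcast : (J : ℝ≥0∞) * (b : ℝ≥0∞) ^ 2 / (a : ℝ≥0∞) ^ 2 = ((J * b ^ 2 / a ^ 2 : ℝ≥0) : ℝ≥0∞) := by
    rw [ENNReal.coe_div (pow_ne_zero 2 hane)]
    push_cast
    rfl
  rw [hcast]
  have := mul_add_div_le_of_sq_le ha (by exact_mod_cast hquad)
  exact_mod_cast this

end UProc

theorem mainTheorem4 :
    ∃ C : ℝ≥0, 0 < C ∧
      ∀ {Ω : Type*} {χ : Type*} [MeasurableSpace Ω] [MeasurableSpace χ]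
        (μ : Measure Ω) [IsProbabilityMeasure μ] (n : ℕ) (_ : 2 ≤ n)
        (X : Fin n → Ω → χ) (ε : Fin n → Ω → ℝ)
        (_ : ∀ i, Measurable (X i)) (_ : iIndepFun X μ)
        (_ : ∀ i, UProc.IsRademacher μ (ε i)) (_ : iIndepFun ε μ)
        (_ : IndepFun (fun ω i => X i ω) (fun ω i => ε i ω) μ)
        (𝓕 : Set (UProc.Kernels n χ)) (_ : 𝓕.Countable) (_ : 𝓕.Nonempty)
        (_ : ∀ f ∈ 𝓕, ∀ i j, i ≠ j → Measurable (Function.uncurry (f i j)))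
        (R : ℝ) (_ : ∀ f ∈ 𝓕, ∀ i j, i ≠ j → ∀ x x', |f i j x x'| ≤ R)
        (F : UProc.Kernels n χ)
        (_ : ∀ i j, i ≠ j → Measurable (Function.uncurry (F i j)))
        (_ : ∀ f ∈ 𝓕, ∀ i j, i ≠ j → ∀ x x', |f i j x x'| ≤ F i j x x')
        (_ : UProc.normP μ X F ≠ 0) (_ : UProc.normP μ X F ≠ ∞)
        (a b : ℝ≥0) (_ : 0 < a) (_ : UProc.A μ X F 𝓕 ≤ a) (_ : UProc.B μ X F R ≤ b),
        UProc.expectedSup μ X ε 𝓕 ≤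
            C * UProc.normP μ X F * UProc.J₂ 1 F 𝓕 a *
              (1 + UProc.J₂ 1 F 𝓕 a * (b : ℝ≥0∞) ^ 2 / (a : ℝ≥0∞) ^ 2) ∧
        (0 ∈ 𝓕 →
          UProc.expectedSup μ X ε 𝓕 ≤
            C * UProc.normP μ X F * UProc.J₂ 0 F 𝓕 a *
              (1 + UProc.J₂ 0 F 𝓕 a * (b : ℝ≥0∞) ^ 2 / (a : ℝ≥0∞) ^ 2)) := by
  refine ⟨5000000, by norm_num, ?_⟩
  intro Ω χ _ _ μ _ n hn X ε hX hind hε hεind hXε 𝓕 h𝓕 hne hm R hR F hFm hF hP0 hPtop a b ha hA hB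
  exact ⟨UProc.expectedSup_le μ hn X ε hX hind hε hεind hXε h𝓕 hne hm hR hFm hF hP0 hPtop ha hA hB
      (Or.inl rfl),
    fun h0 => UProc.expectedSup_le μ hn X ε hX hind hε hεind hXε h𝓕 hne hm hR hFm hF hP0 hPtop ha
      hA hB (Or.inr ⟨rfl, h0⟩)⟩
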